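/- **Setting.** All signal spaces are Euclidean: vectors $\mathbb R^d$ or images $\mathbb R^{c\times h\times w}$ with the $\ell_2$ norm. For a map $f$ between such spaces let $\operatorname{Lip}(f)=\sup_{x\ne x'}\|f(x)-f(x')\|/\|x-x'\|$, and for a class of maps let $\operatorname{Lip}(\mathcal G)=\sup_{f\in\mathcal G}\operatorname{Lip}(f)$. A *fully-connected layer* is a map $x\mapsto Ax$ with a weight matrix $A$; put $\|A\|_{2,1}=\sum_i(\sum_j A_{ij}^2)^{1/2}$ ($i$ runs over outputs, $j$ over inputs). A *convolutional layer* with weight tensor $K\in\mathbb R^{c_{out}\times c_{in}\times k_h\times k_w}$ and strides $s_h,s_w\ge1$ is the zero-padded map $\phi_K:\mathbb R^{c_{in}\times h\times w}\to\mathbb R^{c_{out}\times\lceil h/s_h\rceil\times\lceil w/s_w\rceil}$, $$[\phi_K(x)]_{\sigma\mu\nu}=\sum_{r=1}^{c_{in}}\ \sum_{i=\lfloor-\frac{k_h-1}2\rfloor}^{\lfloor\frac{k_h-1}2\rfloor}\ \sum_{j=\lfloor-\frac{k_w-1}2\rfloor}^{\lfloor\frac{k_w-1}2\rfloor}K_{\sigma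 rij}\,x_{r,\,1+s_h(\mu-1)+i,\,1+s_w(\nu-1)+j},$$ where entries of $x$ outside the image are read as $0$; put $\|K\|_{2,1}=\sum_{i,k,l}(\sum_j K_{ijkl}^2)^{1/2}$ (the inner sum runs over the input channels). For $i=1,\dots,L$ and $j=1,\dots,L_i$ let $s_{ij},b_{ij}>0$, and fix $\rho_i$-Lipschitz maps $\sigma_i$ and $\rho_{ij}$-Lipschitz maps $\sigma_{ij}$ between signal spaces of matching shapes, with $\sigma_i(0)=0$ and $\sigma_{ij}(0)=0$. Fix for every $(i,j)$ the type (fully-connected or convolutional, with its sizes) of a layer and reference weights $K^{(0)}_{ij}$, respectively $A^{(0)}_{ij}$. Let $\mathcal F_i$ be the class of residual blocks $$f_i=\mathrm{Id}+\sigma_{iL_i}\circ f_{iL_i}\circ\dots\circ\sigma_{i1}\circ f_{i1},$$ where each layer $f_{ij}$ satisfies $\operatorname{Lip}(f_{ij})\le s_{ij}$ and its weights satisfy $\|K_{ij}-K_{ij}^{(0)}\|_{2,1}\le b_{ij}$, respectively $\|A_{ij}-A_{ij}^{(0)}\|_{2,1}\le b_{ij}$. Let $\mathcal F$ be the class of networks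 $f=\sigma_L\circ f_L\circ\dots\circ\sigma_1\circ f_1$ with $f_i\in\mathcal F_i$, mapping the input space to $\mathbb R^\kappa$, $\kappa\ge2$. Let $W_{ij}$ be the number of parameters of layer $(i,j)$, $W=\max_{ij}W_{ij}$, $\bar L=\sum_{i=1}^L L_i$. For $\gamma>0$ and data $X=(x_1,\dots,x_n)$ with $\|X\|=(\sum_k\|x_k\|^2)^{1/2}$ put $$\tilde C_{ij}=\frac4\gamma\,\frac{\|X\|}{\sqrt n}\Bigl(\prod_{l=1}^L\operatorname{Lip}(\mathcal F_l)\,\rho_l\Bigr)\frac{\prod_{k=1}^{L_i}\rho_{ik}s_{ik}}{\operatorname{Lip}(\mathcal F_i)}\,\frac{b_{ij}}{s_{ij}}$$ (read as $0$ if $\operatorname{Lip}(\mathcal F_i)=0$). Let $H_{n-1}=\sum_{m=1}^{n-1}\frac1m$, $\zeta(s,q)=\sum_{m=0}^\infty(q+m)^{-s}$, and $\psi(a)=\zeta(\tfrac32,1)^{1/3}\,\zeta(\tfrac32,1+\tfrac1a)^{2/3}$ for $a>0$, $\psi(0)=0$. With the margin $\mathcal M(v,y)=v_y-\max_{i\ne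 y}v_i$ and the ramp loss $\ell_\gamma(r)=(1+r/\gamma)\mathbb 1_{r\in[-\gamma,0]}+\mathbb 1_{r>0}$, let $\hat{\mathcal R}_\gamma(f)=\frac1n\sum_{k=1}^n\ell_\gamma(-\mathcal M(f(x_k),y_k))$. **Theorem.** Let $n\ge1$, $\gamma>0$, $\delta\in(0,1)$, and let $(x_1,y_1),\dots,(x_n,y_n)$ be drawn i.i.d. from a probability measure on pairs of an input $x$ and a label $y\in\{1,\dots,\kappa\}$. Then, with probability at least $1-\delta$ over the sample, every $f\in\mathcal F$ satisfies both $$\mathbb P\bigl[\operatorname*{argmax}_{i} f(x)_i\ne y\bigr]\le\hat{\mathcal R}_\gamma(f)+\frac8n+24\sqrt{\log(2W)}\Bigl(\sum_{i=1}^L\sum_{j=1}^{L_i}\bigl\lceil\tilde C_{ij}^{2/3}\bigr\rceil\Bigr)^{3/2}\frac{H_{n-1}}{\sqrt n}+3\sqrt{\frac{\log(2/\delta)}{2n}}$$ and $$\mathbb P\bigl[\operatorname*{argmax}_{i} f(x)_i\ne y\bigr]\le\hat{\mathcal R}_\gamma(f)+\frac{24}{\sqrt n}\sqrt{2\sum_{i=1}^L\sum_{j=1}^{L_i}W_{ij}\Bigl(\log\bigl(1+\lceil\bar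 L^2\tilde C_{ij}^2\rceil\bigr)+\psi\bigl(\lceil\bar L^2\tilde C_{ij}^2\rceil\bigr)\Bigr)}+3\sqrt{\frac{\log(2/\delta)}{2n}}.$$ A point $(x,y)$ at which the maximum of $f(x)$ is attained more than once counts as misclassified. -/

import Mathlib

open scoped NNReal ENNReal

noncomputable section

namespace ResNet

/-! ### Signals -/

/-- The shape of a signal: a vector of length `d`, or an image with `c` channels, height `h` and
width `w`. -/
inductive Shape : Type
  | vec (d : ℕ) : Shape
  | img (c h w : ℕ) : Shape

/-- The index set of the coordinates of a signal. -/
abbrev Shape.Idx : Shape → Type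
  | .vec d => Fin d
  | .img c h w => Fin c × Fin h × Fin w

instance Shape.instFintypeIdx : (p : Shape) → Fintype p.Idx
  | .vec d => inferInstanceAs (Fintype (Fin d))
  | .img c h w => inferInstanceAs (Fintype (Fin c × Fin h × Fin w))

/-- The Euclidean space `ℝ^d`, respectively `ℝ^(c × h × w)`, of signals of a given shape. -/
abbrev Shape.Space (p : Shape) : Type := EuclideanSpace ℝ p.Idx

/-! ### Lipschitz constants -/

/-- `Lip(f) = sup_{x, y} ‖f x - f y‖ / ‖x - y‖` (the pairs `x = y` contribute `0 / 0 = 0`). -/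
def lip {p q : Shape} (f : p.Space → q.Space) : ℝ≥0∞ :=
  ⨆ (x : p.Space) (y : p.Space), edist (f x) (f y) / edist x y

/-- `Lip(F) = sup_{f ∈ F} Lip(f)`. -/
def lipClass {p q : Shape} (F : Set (p.Space → q.Space)) : ℝ≥0∞ := ⨆ f ∈ F, lip f

/-! ### Fully-connected and convolutional layers -/

/-- The `(2,1)` group norm of a weight matrix: the sum over the output coordinates `i` of the
`ℓ₂` norm taken along the input coordinates `j`. -/
def matrixNorm21 {I J : Type} [Fintype I] [Fintype J] (A : Matrix I J ℝ) : ℝ :=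
  ∑ i, √(∑ j, A i j ^ 2)

/-- Weight tensors with `cout` output and `cin` input channels and kernel size `kh × kw`. -/
abbrev Tensor (cout cin kh kw : ℕ) : Type := Fin cout → Fin cin → Fin kh → Fin kw → ℝ

/-- The `(2,1)` group norm of a weight tensor: `∑_{i,k,l} (∑_j K_{ijkl}²)^{1/2}`, i.e. the sum of
the `ℓ₂` norms taken along the input channels. -/
def tensorNorm21 {cout cin kh kw : ℕ} (K : Tensor cout cin kh kw) : ℝ :=
  ∑ i, ∑ k, ∑ l, √(∑ j, K i j k l ^ 2)

/-- The pixel of channel `r` at the (zero-based) position `(u, v)`, and `0` outside the image. -/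
def zeroPad {c h w : ℕ} (x : (Shape.img c h w).Space) (r : Fin c) (u v : ℤ) : ℝ :=
  if huv : (0 ≤ u ∧ u < h) ∧ (0 ≤ v ∧ v < w) then
    x (r, ⟨u.toNat, by omega⟩, ⟨v.toNat, by omega⟩)
  else 0

/-- The 2D convolution with weight tensor `K`, strides `(sh, sw)` and zero padding. The kernel
index `a : Fin kh` stands for the offset `a - ⌊kh / 2⌋`, so that the offsets run from
`⌊-(kh - 1) / 2⌋` to `⌊(kh - 1) / 2⌋`, and similarly for `b : Fin kw`. -/
def conv {cout cin kh kw : ℕ} (h w sh sw : ℕ) (K : Tensor cout cin kh kw)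
    (x : (Shape.img cin h w).Space) : (Shape.img cout (h ⌈/⌉ sh) (w ⌈/⌉ sw)).Space :=
  WithLp.toLp 2 fun o : Fin cout × Fin (h ⌈/⌉ sh) × Fin (w ⌈/⌉ sw) =>
    ∑ r : Fin cin, ∑ a : Fin kh, ∑ b : Fin kw,
      K o.1 r a b *
        zeroPad x r ((sh : ℤ) * (o.2.1 : ℕ) + (a : ℕ) - ((kh / 2 : ℕ) : ℤ))
          ((sw : ℤ) * (o.2.2 : ℕ) + (b : ℕ) - ((kw / 2 : ℕ) : ℤ))

/-- The kinds of layers, with the shapes of their inputs and outputs. -/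
inductive Layer : Shape → Shape → Type
  /-- a fully-connected layer -/
  | fc (p q : Shape) : Layer p q
  /-- a convolutional layer with `cin` input and `cout` output channels, kernel size `kh × kw` and
  strides `sh, sw ≥ 1`, acting on images of height `h` and width `w` -/
  | conv (cin cout h w kh kw sh sw : ℕ) (hsh : 0 < sh) (hsw : 0 < sw) :
      Layer (.img cin h w) (.img cout (h ⌈/⌉ sh) (w ⌈/⌉ sw))

/-- The weights of a layer: a matrix, respectively a tensor. -/
def Layer.Weight : {p q : Shape} → Layer p q → Type
  | _, _, .fc p q => Matrix q.Idx p.Idx ℝ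
  | _, _, .conv cin cout _ _ kh kw _ _ _ _ => Tensor cout cin kh kw

/-- The number of parameters of a layer. -/
def Layer.numParams : {p q : Shape} → Layer p q → ℕ
  | _, _, .fc p q => Fintype.card q.Idx * Fintype.card p.Idx
  | _, _, .conv cin cout _ _ kh kw _ _ _ _ => cout * cin * kh * kw

/-- The linear map that a layer computes with given weights. -/
def Layer.map : {p q : Shape} → (l : Layer p q) → l.Weight → p.Space → q.Space
  | _, _, .fc p q => fun (A : Matrix q.Idx p.Idx ℝ) x => WithLp.toLp 2 (A.mulVec x.ofLp)
  | _, _, .conv _ _ h w _ _ sh sw _ _ => fun K x => ResNet.conv h w sh sw K x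

/-- The distance `‖w - w₀‖_{2,1}` between two weights of a layer. -/
def Layer.dist21 : {p q : Shape} → (l : Layer p q) → l.Weight → l.Weight → ℝ
  | _, _, .fc p q => fun (A A₀ : Matrix q.Idx p.Idx ℝ) => matrixNorm21 (A - A₀)
  | _, _, .conv cin cout _ _ kh kw _ _ _ _ =>
      fun (K K₀ : Tensor cout cin kh kw) => tensorNorm21 (K - K₀)

/-! ### Compositions -/

/-- A finite sequence of composable arrows `p = p₀ → p₁ → ⋯ → p_m = q` between shapes. -/
inductive Chain (Arr : Shape → Shape → Type) : Shape → Shape → Type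
  | nil (p : Shape) : Chain Arr p p
  | snoc {p q r : Shape} (c : Chain Arr p q) (a : Arr q r) : Chain Arr p r

/-- The list of the values of `g` at the successive arrows of a chain. -/
def Chain.list {Arr : Shape → Shape → Type} {α : Type} (g : {p q : Shape} → Arr p q → α) :
    {p q : Shape} → Chain Arr p q → List α
  | _, _, .nil _ => []
  | _, _, .snoc c a => c.list g ++ [g a]

/-- The class `{φ_m ∘ ⋯ ∘ φ_1 | φ_k ∈ F a_k}` of compositions along a chain `a_1, …, a_m`. -/
def Chain.comp {Arr : Shape → Shape → Type}
    (F : {p q : Shape} → Arr p q → Set (p.Space → q.Space)) :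
    {p q : Shape} → Chain Arr p q → Set (p.Space → q.Space)
  | _, _, .nil _ => {id}
  | _, _, .snoc c a => {φ | ∃ f ∈ c.comp F, ∃ g ∈ F a, φ = g ∘ f}

/-! ### Residual networks -/

/-- A constrained layer `f_{ij}`, with Lipschitz constraint `s`, distance constraint `b` and
reference weight `ref`, followed by a fixed nonlinearity `σ_{ij}`. -/
structure Stage (p q : Shape) where
  mid : Shape
  layer : Layer p mid
  ref : layer.Weight
  s : ℝ
  s_pos : 0 < s
  b : ℝ
  b_pos : 0 < b
  σ : mid.Space → q.Space
  ρ : ℝ≥0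
  σ_lipschitz : LipschitzWith ρ σ
  σ_zero : σ 0 = 0

/-- The class of the maps `σ_{ij} ∘ f_{ij}` with `Lip(f_{ij}) ≤ s_{ij}` and weights at
`(2,1)` distance at most `b_{ij}` from the reference weight. -/
def Stage.functions {p q : Shape} (S : Stage p q) : Set (p.Space → q.Space) :=
  {φ | ∃ w : S.layer.Weight, lip (S.layer.map w) ≤ ENNReal.ofReal S.s ∧
    S.layer.dist21 w S.ref ≤ S.b ∧ φ = S.σ ∘ S.layer.map w}

/-- A residual block `f_i` with identity shortcut, followed by a fixed nonlinearity `σ_i`. -/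
structure Block (p q : Shape) where
  stages : Chain Stage p p
  σ : p.Space → q.Space
  ρ : ℝ≥0
  σ_lipschitz : LipschitzWith ρ σ
  σ_zero : σ 0 = 0

/-- The class `F_i` of the residual blocks
`f_i = Id + σ_{iL_i} ∘ f_{iL_i} ∘ ⋯ ∘ σ_{i1} ∘ f_{i1}`. -/
def Block.residuals {p q : Shape} (B : Block p q) : Set (p.Space → p.Space) :=
  {f | ∃ h ∈ B.stages.comp Stage.functions, f = fun x => x + h x}

/-- The class of the maps `σ_i ∘ f_i`, `f_i ∈ F_i`. -/
def Block.functions {p q : Shape} (B : Block p q) : Set (p.Space → q.Space) :=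
  {φ | ∃ f ∈ B.residuals, φ = B.σ ∘ f}

/-- The number `Lip(F_i)`. -/
def Block.lip {p q : Shape} (B : Block p q) : ℝ := (lipClass B.residuals).toReal

/-- A residual architecture, with its constraints: a chain of residual blocks. -/
abbrev Net (p q : Shape) : Type := Chain Block p q

namespace Net

variable {p q : Shape}

/-- The class `F` of the networks `σ_L ∘ f_L ∘ ⋯ ∘ σ_1 ∘ f_1`. -/
def functions (N : Net p q) : Set (p.Space → q.Space) := Chain.comp Block.functions N

/-- The sum `∑_i ∑_j a_{ij}` over the blocks `i` and the layers `j` of block `i`. -/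
def layerSum (N : Net p q)
    (a : {p' q' : Shape} → Block p' q' → {p'' q'' : Shape} → Stage p'' q'' → ℝ) : ℝ :=
  (N.list fun B => (B.stages.list fun S => a B S).sum).sum

/-- The total number `L̄ = ∑_i L_i` of layers. -/
def numLayers (N : Net p q) : ℝ := N.layerSum fun {_ _} _ {_ _} _ => 1

/-- The maximal number `W = max_{ij} W_{ij}` of parameters of a layer. -/
def maxParams (N : Net p q) : ℕ :=
  (N.list fun B => (B.stages.list fun S => S.layer.numParams).foldr max 0).foldr max 0

/-- The norm `‖X‖ = (∑_k ‖x_k‖²)^{1/2}` of the data. -/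
def dataNorm {n : ℕ} (X : Fin n → p.Space) : ℝ := √(∑ k, ‖X k‖ ^ 2)

/-- The quantity `C̃_{ij}(X)` of the layer `S` in the block `B` of the network `N`:
`(4/γ) (‖X‖/√n) (∏_l Lip(F_l) ρ_l) (∏_k ρ_{ik} s_{ik}) / Lip(F_i) · b_{ij} / s_{ij}`. -/
def capacity (N : Net p q) (γ : ℝ) {n : ℕ} (X : Fin n → p.Space)
    {p' q' : Shape} (B : Block p' q') {p'' q'' : Shape} (S : Stage p'' q'') : ℝ :=
  4 / γ * (dataNorm X / √n) * (N.list fun B' => B'.lip * (B'.ρ : ℝ)).prod *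
    ((B.stages.list fun S' => (S'.ρ : ℝ) * S'.s).prod / B.lip) * (S.b / S.s)

end Net

/-! ### Classification -/

/-- The set of the maximizing labels. -/
def argmax {κ : ℕ} (v : (Shape.vec κ).Space) : Set (Fin κ) := {i | ∀ j, v j ≤ v i}

/-- The probability of misclassification, `P[argmax_i f(x)_i ≠ y]`. A point where the maximum is
attained more than once counts as misclassified. -/
def misclassification {p : Shape} {κ : ℕ} (D : MeasureTheory.Measure (p.Space × Fin κ))
    (f : p.Space → (Shape.vec κ).Space) : ℝ :=
  D.real {z | argmax (f z.1) ≠ {z.2}}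

/-- The margin operator `M(v, y) = v_y - max_{i ≠ y} v_i`. -/
def margin {κ : ℕ} (v : (Shape.vec κ).Space) (y : Fin κ) : ℝ :=
  v y - ⨆ i : {i : Fin κ // i ≠ y}, v i.1

/-- The ramp loss `ℓ_γ(r) = (1 + r/γ) 1_{r ∈ [-γ, 0]} + 1_{r > 0}`. -/
def rampLoss (γ r : ℝ) : ℝ :=
  (Set.Icc (-γ) 0).indicator (fun t => 1 + t / γ) r + (Set.Ioi 0).indicator (fun _ => 1) r

/-- The empirical ramp risk `R̂_γ(f) = (1/n) ∑_k ℓ_γ(-M(f(x_k), y_k))`. -/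
def empiricalRisk {p : Shape} {κ n : ℕ} (γ : ℝ) (S : Fin n → p.Space × Fin κ)
    (f : p.Space → (Shape.vec κ).Space) : ℝ :=
  1 / n * ∑ k, rampLoss γ (-margin (f (S k).1) (S k).2)

/-! ### Special functions -/

/-- The Hurwitz zeta function `ζ(s, q) = ∑_{m ≥ 0} (q + m)^{-s}`, for real `s > 1` and `q > 0`. -/
def hurwitz (s q : ℝ) : ℝ := ∑' m : ℕ, 1 / (q + m) ^ s

/-- `ψ(a) = ζ(3/2, 1)^{1/3} ζ(3/2, 1 + 1/a)^{2/3}` for `a ≠ 0`, extended by its limit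
`ψ(0) = 0`. -/
def psi (a : ℝ) : ℝ :=
  if a = 0 then 0
  else hurwitz (3 / 2) 1 ^ (1 / 3 : ℝ) * hurwitz (3 / 2) (1 + 1 / a) ^ (2 / 3 : ℝ)

/-! ### The two bounds -/

/-- `8/n + 24 √log(2W) (∑_{ij} ⌈C̃_{ij}^{2/3}⌉)^{3/2} H_{n-1} / √n + 3 √(log(2/δ) / (2n))`. -/
def Net.normBound {p q : Shape} (N : Net p q) (γ δ : ℝ) {n : ℕ} (X : Fin n → p.Space) : ℝ :=
  8 / n +
    24 * √(Real.log (2 * N.maxParams)) *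
      (N.layerSum fun {_ _} B {_ _} S => (⌈N.capacity γ X B S ^ (2 / 3 : ℝ)⌉₊ : ℝ)) ^ (3 / 2 : ℝ) *
      (((harmonic (n - 1) : ℚ) : ℝ) / √n) +
    3 * √(Real.log (2 / δ) / (2 * n))

/-- `(24/√n) (2 ∑_{ij} W_{ij} (log(1 + ⌈L̄² C̃_{ij}²⌉) + ψ(⌈L̄² C̃_{ij}²⌉)))^{1/2}
+ 3 √(log(2/δ) / (2n))`. -/
def Net.paramBound {p q : Shape} (N : Net p q) (γ δ : ℝ) {n : ℕ} (X : Fin n → p.Space) : ℝ :=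
  24 / √n *
    √(2 * N.layerSum fun {_ _} B {_ _} S => (S.layer.numParams : ℝ) *
      (Real.log (1 + ⌈N.numLayers ^ 2 * N.capacity γ X B S ^ 2⌉₊) +
        psi ⌈N.numLayers ^ 2 * N.capacity γ X B S ^ 2⌉₊)) +
    3 * √(Real.log (2 / δ) / (2 * n))

end ResNet

end

open scoped NNReal ENNReal

noncomputable section

namespace ResNet

open MeasureTheory ProbabilityTheory

/-! ### Suprema over finite families -/

/-! The ramp loss of the margin equals 1 at every misclassified point, so it suffices to bound its
expectation uniformly over the class by its empirical mean. McDiarmid's inequality is applied once,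
to the uniform deviation minus twice the empirical Rademacher complexity. This difference has
nonpositive mean by symmetrization and changes by at most 3 with one sample point, which gives the
term `3 * √(log(2/δ) / (2n))` (`measure_deviation_gt_le`). Finite families exhaust a countable one,
and a pointwise dense sequence of networks carries the bound to the whole class.

The Rademacher complexity of the loss vectors is bounded by chaining over the radii `√n * 2^(-j)`
(`rademacher_le_chaining`), so only covering numbers are needed. On fixed data a layer minus its
reference is a combination of one feature per parameter, and the `(2,1)` norm controls the total
weight of the combination. Maurey's lemma approximates it by an average of `k` signed atoms up to an
error of order `1/√k`. Such averages number at most `(2W)^k`, and also at most `(k+1)^(2W)`, since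
only multiplicities matter (`exists_cover_of_sum_le`).

Radii are measured relative to the Lipschitz constant times the data norm; under composition they
add up, as do the logarithms of the cardinalities (`IsCoverable.comp`). In a residual block the
identity cancels in differences, so the cover of the residual branch is merely rescaled by its
Lipschitz product over `Lip(F_i)` (`Block.isCoverable`).

The two bounds come from two choices of `k`. With `k` proportional to `⌈C^(2/3)⌉` and the count
`(2W)^k`, the entropy grows like `4^j`; every scale contributes equally, and about `log₂ n` scales
produce the harmonic number. With `k = 4^j ⌈L̄² C²⌉` and the count `(k+1)^(2W)`, the entropy grows
linearly in `j`, so all scales can be summed. -/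

theorem ciSup_le_ciSup_add {ι : Type*} [Finite ι] [Nonempty ι] {a b : ι → ℝ} {c : ℝ}
    (h : ∀ i, a i ≤ b i + c) : ⨆ i, a i ≤ (⨆ i, b i) + c :=
  ciSup_le fun i => (h i).trans
    (add_le_add_left (le_ciSup (Set.finite_range b).bddAbove i) c)

theorem abs_ciSup_le {ι : Type*} [Finite ι] [Nonempty ι] {a : ι → ℝ} {c : ℝ}
    (h : ∀ i, |a i| ≤ c) : |⨆ i, a i| ≤ c := by
  obtain ⟨i⟩ := ‹Nonempty ι›
  rw [abs_le]
  exact ⟨(abs_le.1 (h i)).1.trans (le_ciSup (Set.finite_range a).bddAbove i),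
    ciSup_le fun j => (abs_le.1 (h j)).2⟩

theorem integrable_of_abs_le {Ω : Type*} [MeasurableSpace Ω] {μ : Measure Ω} [IsFiniteMeasure μ]
    {f : Ω → ℝ} (hf : Measurable f) {M : ℝ} (hM : ∀ x, |f x| ≤ M) : Integrable f μ :=
  Integrable.of_bound hf.aestronglyMeasurable M (Filter.Eventually.of_forall hM)

/-! ### The bounded differences inequality -/

section BoundedDifferences

variable {Z : Type*} [MeasurableSpace Z] (μ : Measure Z) [IsProbabilityMeasure μ]

theorem measurable_finCons {n : ℕ} :
    Measurable fun q : Z × (Fin n → Z) => (Fin.cons q.1 q.2 : Fin (n + 1) → Z) := by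
  refine measurable_pi_iff.2 fun i => ?_
  refine Fin.cases ?_ (fun j => ?_) i
  · simpa using measurable_fst
  · simp only [Fin.cons_succ]
    fun_prop

theorem integral_pi_succ {n : ℕ} {g : (Fin (n + 1) → Z) → ℝ} (hg : Measurable g) {M : ℝ}
    (hM : ∀ x, |g x| ≤ M) :
    ∫ x, g x ∂(Measure.pi fun _ : Fin (n + 1) => μ) =
      ∫ z, ∫ x, g (Fin.cons z x) ∂(Measure.pi fun _ : Fin n => μ) ∂μ := by
  have h := (measurePreserving_piFinSuccAbove (fun _ : Fin (n + 1) => μ) 0).symm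
  rw [← h.integral_comp', integral_prod]
  · simp [MeasurableEquiv.piFinSuccAbove, Fin.insertNthEquiv]
  · exact integrable_of_abs_le (hg.comp (MeasurableEquiv.measurable _)) fun x => hM _

/-- **McDiarmid's inequality**: a bounded function of `n` independent variables that changes by at
most `c` when one of them changes is sub-Gaussian with parameter `n (c / 2)²`. -/
theorem hasSubgaussianMGF_of_bounded_differences (c : ℝ≥0) :
    ∀ (n : ℕ) (f : (Fin n → Z) → ℝ), Measurable f → (∃ M, ∀ x, |f x| ≤ M) →
      (∀ x i z, f x - f (Function.update x i z) ≤ c) →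
      HasSubgaussianMGF (fun x => f x - ∫ y, f y ∂(Measure.pi fun _ : Fin n => μ))
        (n * (c / 2) ^ 2) (Measure.pi fun _ : Fin n => μ) := by
  intro n
  induction n with
  | zero =>
    intro f _ _ _
    have h : (fun x => f x - ∫ y, f y ∂(Measure.pi fun _ : Fin 0 => μ)) = fun _ => 0 := by
      funext x
      have : f = fun _ => f x := by
        funext y
        rw [Subsingleton.elim y x]
      rw [this]
      simp
    rw [h]
    simp
  | succ n ih =>
    rintro f hf ⟨M, hM⟩ hc
    have hcons : ∀ z : Z, Measurable fun x : Fin n → Z => f (Fin.cons z x) := fun z =>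
      (hf.comp measurable_finCons).comp measurable_prodMk_left
    set h : Z → ℝ := fun z => ∫ x, f (Fin.cons z x) ∂(Measure.pi fun _ : Fin n => μ) with hh
    have hhm : Measurable h :=
      ((hf.comp measurable_finCons).stronglyMeasurable.integral_prod_right').measurable
    have hhM : ∀ z, |h z| ≤ M := fun z => by
      have := norm_integral_le_of_norm_le_const (μ := Measure.pi fun _ : Fin n => μ)
        (f := fun x => f (Fin.cons z x)) (Filter.Eventually.of_forall fun x => hM _)
      simpa using this
    have hE : ∫ y, f y ∂(Measure.pi fun _ : Fin (n + 1) => μ) = ∫ z, h z ∂μ :=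
      integral_pi_succ μ hf hM
    have hZ : Nonempty Z := nonempty_of_isProbabilityMeasure μ
    -- Averaging out the other coordinates preserves the bounded difference in the first one, so `h`
    -- takes values in an interval of length `c`.
    have hosc : ∀ z z', h z - c ≤ h z' := by
      intro z z'
      rw [sub_le_iff_le_add]
      have hi : ∀ z, Integrable (fun x => f (Fin.cons z x)) (Measure.pi fun _ : Fin n => μ) :=
        fun z => integrable_of_abs_le (hcons z) fun x => hM _
      calc h z ≤ ∫ x, (f (Fin.cons z' x) + c) ∂(Measure.pi fun _ : Fin n => μ) := by
            refine integral_mono (hi z) ((hi z').add (integrable_const _)) fun x => ?_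
            have := hc (Fin.cons z x) 0 z'
            rw [Fin.update_cons_zero] at this
            simp only
            linarith
        _ = h z' + c := by rw [integral_add (hi z') (integrable_const _)]; simp [hh]
    have hbdd : BddBelow (Set.range h) :=
      ⟨-M, by rintro _ ⟨z, rfl⟩; exact (abs_le.1 (hhM z)).1⟩
    -- Hoeffding's lemma for an interval of length `c`.
    have hsub : HasSubgaussianMGF (fun z => h z - ∫ z, h z ∂μ) ((c / 2) ^ 2) μ := by
      have := hasSubgaussianMGF_of_mem_Icc (μ := μ) (X := h) (a := ⨅ z, h z)
        (b := (⨅ z, h z) + c) hhm.aemeasurable (Filter.Eventually.of_forall fun z =>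
          ⟨ciInf_le hbdd z, by
            rw [← sub_le_iff_le_add]
            exact le_ciInf (hosc z)⟩)
      simpa using this
    refine ⟨fun t => ?_, fun t => ?_⟩
    · refine Integrable.of_bound (C := Real.exp (|t| * (M + |∫ y, f y ∂(Measure.pi fun _ : Fin (n + 1) => μ)|)))
        (by fun_prop) (Filter.Eventually.of_forall fun x => ?_)
      rw [Real.norm_eq_abs, Real.abs_exp, Real.exp_le_exp]
      refine (le_abs_self _).trans ?_
      rw [abs_mul]
      gcongr
      exact (abs_sub _ _).trans (by gcongr; exact hM x)
    · rw [mgf, hE]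
      set E := ∫ z, h z ∂μ
      have hb : ∀ x : Fin (n + 1) → Z, |Real.exp (t * (f x - E))| ≤ Real.exp (|t| * (M + |E|)) := by
        intro x
        rw [Real.abs_exp, Real.exp_le_exp]
        refine (le_abs_self _).trans ?_
        rw [abs_mul]
        gcongr
        exact (abs_sub _ _).trans (by gcongr; exact hM x)
      have hm : Measurable fun x => Real.exp (t * (f x - E)) := by fun_prop
      rw [integral_pi_succ μ hm hb]
      -- With the first coordinate frozen, the induction hypothesis controls the fluctuation around
      -- `h z`; the factor left over depends on `z` alone.
      have hin : ∀ z, ∫ x, Real.exp (t * (f (Fin.cons z x) - E)) ∂(Measure.pi fun _ : Fin n => μ)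
          ≤ Real.exp (t * (h z - E)) * Real.exp (n * (c / 2) ^ 2 * t ^ 2 / 2) := by
        intro z
        have := (ih (fun x => f (Fin.cons z x)) (hcons z) ⟨M, fun x => hM _⟩ (fun x i w => by
          have := hc (Fin.cons z x) i.succ w
          rwa [← Fin.cons_update] at this)).mgf_le t
        rw [mgf] at this
        have heq : ∀ x : Fin n → Z, Real.exp (t * (f (Fin.cons z x) - E)) =
            Real.exp (t * (h z - E)) * Real.exp (t * (f (Fin.cons z x) - h z)) := fun x => by
          rw [← Real.exp_add]; ring_nf
        simp_rw [heq]
        rw [integral_const_mul]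
        refine mul_le_mul_of_nonneg_left ?_ (Real.exp_pos _).le
        simpa using this
      have hmeas : Measurable fun z => ∫ x, Real.exp (t * (f (Fin.cons z x) - E))
          ∂(Measure.pi fun _ : Fin n => μ) :=
        ((hm.comp measurable_finCons).stronglyMeasurable.integral_prod_right').measurable
      calc ∫ z, ∫ x, Real.exp (t * (f (Fin.cons z x) - E)) ∂(Measure.pi fun _ : Fin n => μ) ∂μ
          ≤ ∫ z, Real.exp (t * (h z - E)) * Real.exp (n * (c / 2) ^ 2 * t ^ 2 / 2) ∂μ := by
            refine integral_mono_of_nonneg (Filter.Eventually.of_forall fun z =>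
              integral_nonneg fun x => (Real.exp_pos _).le)
              ((hsub.integrable_exp_mul t).mul_const _) (Filter.Eventually.of_forall hin)
        _ = mgf (fun z => h z - E) μ t * Real.exp (n * (c / 2) ^ 2 * t ^ 2 / 2) := by
            rw [integral_mul_const, mgf]
        _ ≤ Real.exp (((c / 2) ^ 2 : ℝ≥0) * t ^ 2 / 2) *
              Real.exp (n * (c / 2) ^ 2 * t ^ 2 / 2) := by
            gcongr
            exact hsub.mgf_le t
        _ = _ := by
            rw [← Real.exp_add]
            push_cast
            ring_nf

end BoundedDifferences

theorem integral_comp_of_measurePreserving {Ω Ω' : Type*} [MeasurableSpace Ω]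
    [MeasurableSpace Ω'] {μ : Measure Ω} {ν : Measure Ω'} {f : Ω → Ω'}
    (hf : MeasurePreserving f μ ν) {g : Ω' → ℝ} (hg : Measurable g) :
    ∫ x, g (f x) ∂μ = ∫ y, g y ∂ν := by
  rw [← hf.map_eq, integral_map hf.measurable.aemeasurable hg.aestronglyMeasurable]

/-! ### Rademacher complexity -/

/-- The value `1` or `-1` of a Rademacher sign. -/
def rsign (b : Bool) : ℝ := if b then 1 else -1

theorem abs_rsign (b : Bool) : |rsign b| = 1 := by cases b <;> simp [rsign]

theorem rsign_not (b : Bool) : rsign (!b) = -rsign b := by cases b <;> simp [rsign]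

/-- The expectation of `sup_i ∑_k ε_k v_{ik}` over uniformly distributed signs `ε_k`. -/
def rademacher {ι : Type*} {n : ℕ} (v : ι → Fin n → ℝ) : ℝ :=
  (∑ ε : Fin n → Bool, ⨆ i, ∑ k, rsign (ε k) * v i k) / 2 ^ n

theorem sum_signs_const (n : ℕ) (c : ℝ) : (∑ _ε : Fin n → Bool, c) / 2 ^ n = c := by
  simp

theorem abs_sum_rsign_mul_le {n : ℕ} (ε : Fin n → Bool) {v : Fin n → ℝ} (hv : ∀ k, |v k| ≤ 1) :
    |∑ k, rsign (ε k) * v k| ≤ n := by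
  refine (Finset.abs_sum_le_sum_abs _ _).trans ?_
  calc ∑ k, |rsign (ε k) * v k| ≤ ∑ _k : Fin n, (1 : ℝ) :=
        Finset.sum_le_sum fun k _ => by rw [abs_mul, abs_rsign, one_mul]; exact hv k
    _ = n := by simp

theorem sum_update_le {Z : Type*} {n : ℕ} {h : Z → ℝ} {c : ℝ} (hc : ∀ z z', h z - h z' ≤ c) (a : Fin n → ℝ)
    (ha : ∀ k, |a k| = 1) (hc' : ∀ z z', h z' - h z ≤ c) (x : Fin n → Z) (i : Fin n) (z : Z) :
    ∑ k, a k * h (x k) ≤ ∑ k, a k * h (Function.update x i z k) + c := by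
  rw [← sub_le_iff_le_add', ← Finset.sum_sub_distrib, Finset.sum_eq_single i]
  · rw [Function.update_self, ← mul_sub]
    refine (le_abs_self _).trans ?_
    rw [abs_mul, ha, one_mul, abs_le]
    exact ⟨by linarith [hc' (x i) z], hc _ _⟩
  · intro k _ hk
    rw [Function.update_of_ne hk, sub_self]
  · simp

/-- Only one summand changes, by at most 1. Counted twice and added to the same constant for the
deviation, this yields the difference bound 3 in McDiarmid's inequality. -/
theorem rademacher_update_le {Z ι : Type*} [Finite ι] [Nonempty ι] {g : ι → Z → ℝ} {n : ℕ}
    (h01 : ∀ i z, g i z ∈ Set.Icc (0 : ℝ) 1) (x : Fin n → Z) (j : Fin n)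
    (z : Z) : rademacher (fun i k => g i (Function.update x j z k)) ≤
      rademacher (fun i k => g i (x k)) + 1 := by
  unfold rademacher
  rw [← sum_signs_const n 1, ← add_div, ← Finset.sum_add_distrib]
  gcongr with ε
  refine ciSup_le_ciSup_add fun i => ?_
  have := sum_update_le (h := g i) (c := 1)
    (fun z z' => by linarith [(h01 i z).2, (h01 i z').1]) (fun k => rsign (ε k))
    (fun k => abs_rsign _) (fun z z' => by linarith [(h01 i z').2, (h01 i z).1])
    (Function.update x j z) j (x j)
  simpa using this

section Symmetrization

variable {Z : Type*} [MeasurableSpace Z] (μ : Measure Z) [IsProbabilityMeasure μ]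
  {ι : Type*} {g : ι → Z → ℝ} {n : ℕ}

theorem measurable_rademacher [Finite ι] (hg : ∀ i, Measurable (g i)) :
    Measurable fun x : Fin n → Z => rademacher fun i k => g i (x k) := by
  unfold rademacher
  have : Countable ι := Finite.to_countable
  refine (Finset.measurable_sum _ fun ε _ => ?_).div_const _
  refine Measurable.iSup fun i => ?_
  fun_prop

theorem abs_rademacher_le [Finite ι] [Nonempty ι] {v : ι → Fin n → ℝ} (hv : ∀ i k, |v i k| ≤ 1) :
    |rademacher v| ≤ n := by
  unfold rademacher
  rw [abs_div, abs_of_pos (a := (2 : ℝ) ^ n) (by positivity), ← sum_signs_const n n]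
  gcongr
  refine (Finset.abs_sum_le_sum_abs _ _).trans (Finset.sum_le_sum fun ε _ => ?_)
  exact abs_ciSup_le fun i => abs_sum_rsign_mul_le ε (hv i)

/-- The uniform deviation `sup_i ∑_k (E g_i - g_i(x_k))`. -/
def deviation (g : ι → Z → ℝ) (x : Fin n → Z) : ℝ :=
  ⨆ i, ∑ k, (∫ z, g i z ∂μ - g i (x k))

omit [IsProbabilityMeasure μ] in
theorem measurable_deviation [Finite ι] (hg : ∀ i, Measurable (g i)) :
    Measurable (deviation μ g : (Fin n → Z) → ℝ) := by
  unfold deviation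
  have : Countable ι := Finite.to_countable
  refine Measurable.iSup fun i => ?_
  fun_prop

theorem integral_mem_Icc (hg : ∀ i, Measurable (g i)) (h01 : ∀ i z, g i z ∈ Set.Icc (0 : ℝ) 1)
    (i : ι) : ∫ z, g i z ∂μ ∈ Set.Icc (0 : ℝ) 1 := by
  refine ⟨integral_nonneg fun z => (h01 i z).1, ?_⟩
  have hi : Integrable (g i) μ := integrable_of_abs_le (hg i) (M := 1) fun z =>
    abs_le.2 ⟨by linarith [(h01 i z).1], (h01 i z).2⟩
  simpa using integral_mono hi (integrable_const 1) fun z => (h01 i z).2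

theorem abs_deviation_le [Finite ι] [Nonempty ι] (hg : ∀ i, Measurable (g i)) (h01 : ∀ i z, g i z ∈ Set.Icc (0 : ℝ) 1)
    (x : Fin n → Z) : |deviation μ g x| ≤ n := by
  unfold deviation
  refine abs_ciSup_le fun i => (Finset.abs_sum_le_sum_abs _ _).trans ?_
  have hi := integral_mem_Icc μ hg h01 i
  calc ∑ k, |∫ z, g i z ∂μ - g i (x k)| ≤ ∑ _k : Fin n, (1 : ℝ) :=
        Finset.sum_le_sum fun k _ => abs_le.2
          ⟨by linarith [hi.1, (h01 i (x k)).2], by linarith [hi.2, (h01 i (x k)).1]⟩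
    _ = n := by simp

omit [IsProbabilityMeasure μ] in
theorem deviation_update_le [Finite ι] [Nonempty ι] (h01 : ∀ i z, g i z ∈ Set.Icc (0 : ℝ) 1) (x : Fin n → Z) (j : Fin n)
    (z : Z) : deviation μ g x ≤ deviation μ g (Function.update x j z) + 1 := by
  unfold deviation
  refine ciSup_le_ciSup_add fun i => ?_
  have := sum_update_le (h := g i) (c := 1)
    (fun z z' => by linarith [(h01 i z).2, (h01 i z').1]) (fun _ => -1)
    (fun k => by simp) (fun z z' => by linarith [(h01 i z').2, (h01 i z).1]) x j z
  simp only [Finset.sum_sub_distrib, neg_one_mul, Finset.sum_neg_distrib] at this ⊢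
  linarith

/-- Exchanging the two copies of the variables with a negative sign. -/
theorem integral_swap_signs [Finite ι] (ε : Fin n → Bool) (hg : ∀ i, Measurable (g i)) :
    ∫ ω : Fin n → Z × Z, (⨆ i, ∑ k, (g i (ω k).2 - g i (ω k).1))
        ∂(Measure.pi fun _ => μ.prod μ) =
      ∫ ω : Fin n → Z × Z, (⨆ i, ∑ k, rsign (ε k) * (g i (ω k).2 - g i (ω k).1))
        ∂(Measure.pi fun _ => μ.prod μ) := by
  have : Countable ι := Finite.to_countable
  have hs : MeasurePreserving
      (fun (ω : Fin n → Z × Z) k => (if ε k then id else Prod.swap : Z × Z → Z × Z) (ω k))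
      (Measure.pi fun _ => μ.prod μ) (Measure.pi fun _ => μ.prod μ) := by
    refine measurePreserving_pi (fun _ => μ.prod μ) (fun _ => μ.prod μ) fun k => ?_
    cases ε k
    · simpa using Measure.measurePreserving_swap (μ := μ) (ν := μ)
    · simpa using MeasurePreserving.id _
  have hm : Measurable fun ω : Fin n → Z × Z => ⨆ i, ∑ k, (g i (ω k).2 - g i (ω k).1) := by
    refine Measurable.iSup fun i => ?_
    fun_prop
  conv_lhs => rw [← hs.map_eq]
  rw [integral_map hs.measurable.aemeasurable hm.aestronglyMeasurable]
  refine integral_congr_ae (Filter.Eventually.of_forall fun ω => ?_)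
  simp only
  congr 1 with i
  refine Finset.sum_congr rfl fun k _ => ?_
  cases ε k <;> simp [rsign]

/-- Symmetrization: a ghost sample replaces the expectations, and the joint law of both samples is
invariant under coordinatewise exchange, so random signs may be inserted. -/
theorem integral_deviation_le [Finite ι] [Nonempty ι] (hg : ∀ i, Measurable (g i))
    (h01 : ∀ i z, g i z ∈ Set.Icc (0 : ℝ) 1) :
    ∫ x, deviation μ g x ∂(Measure.pi fun _ : Fin n => μ) ≤
      2 * ∫ x, rademacher (fun i k => g i (x k)) ∂(Measure.pi fun _ : Fin n => μ) := by
  have hcount : Countable ι := Finite.to_countable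
  have habs : ∀ i z, |g i z| ≤ 1 := fun i z =>
    abs_le.2 ⟨by linarith [(h01 i z).1], (h01 i z).2⟩
  set P := Measure.pi fun _ : Fin n => μ with hP
  set Q := Measure.pi fun _ : Fin n => μ.prod μ with hQ
  have hdiff : ∀ i z z', |g i z' - g i z| ≤ 1 := fun i z z' => abs_le.2
    ⟨by linarith [(h01 i z).2, (h01 i z').1], by linarith [(h01 i z).1, (h01 i z').2]⟩
  have hsm : ∀ a : Fin n → ℝ,
      Measurable fun x : Fin n → Z => ⨆ i, ∑ k, a k * g i (x k) := fun a => by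
    refine Measurable.iSup fun i => ?_
    fun_prop
  have hsb : ∀ (ε : Fin n → Bool) (x : Fin n → Z), |⨆ i, ∑ k, rsign (ε k) * g i (x k)| ≤ n :=
    fun ε x => abs_ciSup_le fun i => abs_sum_rsign_mul_le ε fun k => habs i (x k)
  have hFm : Measurable fun q : (Fin n → Z) × (Fin n → Z) =>
      ⨆ i, ∑ k, (g i (q.2 k) - g i (q.1 k)) := by
    refine Measurable.iSup fun i => ?_
    fun_prop
  have hFb : ∀ x y : Fin n → Z, |⨆ i, ∑ k, (g i (y k) - g i (x k))| ≤ n := fun x y => by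
    refine abs_ciSup_le fun i => ?_
    simpa [rsign] using abs_sum_rsign_mul_le (fun _ => true) fun k => hdiff i (x k) (y k)
  have hfst : MeasurePreserving (fun (ω : Fin n → Z × Z) k => (ω k).1) Q P :=
    measurePreserving_pi (fun _ => μ.prod μ) (fun _ => μ) fun _ => measurePreserving_fst
  have hsnd : MeasurePreserving (fun (ω : Fin n → Z × Z) k => (ω k).2) Q P :=
    measurePreserving_pi (fun _ => μ.prod μ) (fun _ => μ) fun _ => measurePreserving_snd
  -- Each expectation is an average over the ghost sample `y`; the supremum of averages is at most
  -- the average of suprema.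
  have h1 : ∫ x, deviation μ g x ∂P ≤
      ∫ x, ∫ y, (⨆ i, ∑ k, (g i (y k) - g i (x k))) ∂P ∂P := by
    refine integral_mono (integrable_of_abs_le (measurable_deviation μ hg)
      (abs_deviation_le μ hg h01)) ?_ fun x => ?_
    · refine integrable_of_abs_le (M := n)
        (hFm.stronglyMeasurable.integral_prod_right').measurable fun x => ?_
      have := norm_integral_le_of_norm_le_const (μ := P)
        (f := fun y => ⨆ i, ∑ k, (g i (y k) - g i (x k))) (C := n)
        (Filter.Eventually.of_forall fun y => hFb x y)
      simpa using this
    · refine ciSup_le fun i => ?_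
      have hev : ∀ k, Integrable (fun y : Fin n → Z => g i (y k)) P := fun k =>
        integrable_of_abs_le (by fun_prop) fun y => habs i (y k)
      have : ∑ k, (∫ z, g i z ∂μ - g i (x k)) = ∫ y, ∑ k, (g i (y k) - g i (x k)) ∂P := by
        rw [integral_finsetSum (f := fun k (y : Fin n → Z) => g i (y k) - g i (x k)) _
          fun k _ => (hev k).sub (integrable_const _)]
        refine Finset.sum_congr rfl fun k _ => ?_
        rw [integral_sub (hev k) (integrable_const _)]
        congr 1
        · exact (integral_comp_of_measurePreserving
            (measurePreserving_eval (fun _ : Fin n => μ) k) (hg i)).symm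
        · simp
      rw [this]
      refine integral_mono (integrable_finsetSum _ fun k _ => (hev k).sub (integrable_const _))
        (integrable_of_abs_le (hFm.comp measurable_prodMk_left) fun y => hFb x y) fun y => ?_
      exact le_ciSup (f := fun i => ∑ k, (g i (y k) - g i (x k)))
        (Set.finite_range _).bddAbove i
  have h2 : ∫ x, ∫ y, (⨆ i, ∑ k, (g i (y k) - g i (x k))) ∂P ∂P =
      ∫ ω : Fin n → Z × Z, (⨆ i, ∑ k, (g i (ω k).2 - g i (ω k).1)) ∂Q := by
    have hpp := measurePreserving_arrowProdEquivProdArrow Z Z (Fin n) (fun _ => μ) (fun _ => μ)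
    rw [← integral_prod (f := fun q : (Fin n → Z) × (Fin n → Z) =>
      ⨆ i, ∑ k, (g i (q.2 k) - g i (q.1 k)))
      (integrable_of_abs_le hFm fun q => hFb q.1 q.2), ← hpp.integral_comp']
    rfl
  have h3 : ∀ ε : Fin n → Bool,
      ∫ ω : Fin n → Z × Z, (⨆ i, ∑ k, (g i (ω k).2 - g i (ω k).1)) ∂Q ≤
        ∫ x, (⨆ i, ∑ k, rsign (ε k) * g i (x k)) ∂P +
          ∫ x, (⨆ i, ∑ k, rsign (!ε k) * g i (x k)) ∂P := by
    intro ε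
    have hi1 : Integrable (fun x : Fin n → Z => ⨆ i, ∑ k, rsign (ε k) * g i (x k)) P :=
      integrable_of_abs_le (hsm _) (hsb ε)
    have hi2 : Integrable (fun x : Fin n → Z => ⨆ i, ∑ k, rsign (!ε k) * g i (x k)) P :=
      integrable_of_abs_le (hsm _) (hsb fun k => !ε k)
    rw [integral_swap_signs μ ε hg, ← integral_comp_of_measurePreserving hsnd (hsm _),
      ← integral_comp_of_measurePreserving hfst (hsm _), ← integral_add]
    · refine integral_mono ?_ ?_ fun ω => ?_
      · refine integrable_of_abs_le (M := n) (Measurable.iSup fun i => by fun_prop) fun ω =>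
          abs_ciSup_le fun i => abs_sum_rsign_mul_le ε fun k => hdiff i _ _
      · exact (hsnd.integrable_comp_of_integrable hi1).add
          (hfst.integrable_comp_of_integrable hi2)
      · refine ciSup_le fun i => ?_
        have e1 := le_ciSup (f := fun i => ∑ k, rsign (ε k) * g i (ω k).2)
          (Set.finite_range _).bddAbove i
        have e2 := le_ciSup (f := fun i => ∑ k, rsign (!ε k) * g i (ω k).1)
          (Set.finite_range _).bddAbove i
        refine le_trans (le_of_eq ?_) (add_le_add e1 e2)
        rw [← Finset.sum_add_distrib]
        refine Finset.sum_congr rfl fun k _ => ?_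
        rw [rsign_not]
        ring
    · exact hsnd.integrable_comp_of_integrable hi1
    · exact hfst.integrable_comp_of_integrable hi2
  calc _ ≤ _ := h1
    _ = _ := h2
    _ = (∑ _ε : Fin n → Bool, ∫ ω : Fin n → Z × Z,
          (⨆ i, ∑ k, (g i (ω k).2 - g i (ω k).1)) ∂Q) / 2 ^ n := (sum_signs_const n _).symm
    _ ≤ (∑ ε : Fin n → Bool, (∫ x, (⨆ i, ∑ k, rsign (ε k) * g i (x k)) ∂P +
          ∫ x, (⨆ i, ∑ k, rsign (!ε k) * g i (x k)) ∂P)) / 2 ^ n := by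
        gcongr with ε
        exact h3 ε
    _ = 2 * ∫ x, rademacher (fun i k => g i (x k)) ∂P := by
        simp only [rademacher]
        rw [integral_div, integral_finsetSum _ fun ε _ => integrable_of_abs_le (hsm _) (hsb ε),
          Finset.sum_add_distrib]
        -- Flipping all signs permutes the sign vectors, so the two copies contribute equally; hence
        -- the factor 2.
        have : ∑ ε : Fin n → Bool, ∫ x, (⨆ i, ∑ k, rsign (!ε k) * g i (x k)) ∂P =
            ∑ ε : Fin n → Bool, ∫ x, (⨆ i, ∑ k, rsign (ε k) * g i (x k)) ∂P :=
          Equiv.sum_comp (Equiv.arrowCongr (Equiv.refl (Fin n)) Equiv.boolNot)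
            fun ε : Fin n → Bool => ∫ x, (⨆ i, ∑ k, rsign (ε k) * g i (x k)) ∂P
        rw [this]
        ring

/-- A finite family of functions with values in `[0, 1]` satisfies the uniform bound
`∑ (E g_i - g_i(x_k)) ≤ 2 rad + 3 √(n t / 2)` up to an event of probability `exp (-t)`. -/
theorem measure_deviation_gt_le [Finite ι] [Nonempty ι] (hg : ∀ i, Measurable (g i))
    (h01 : ∀ i z, g i z ∈ Set.Icc (0 : ℝ) 1) (hn : 1 ≤ n) {t : ℝ} (ht : 0 ≤ t) :
    (Measure.pi fun _ : Fin n => μ) {x | 2 * rademacher (fun i k => g i (x k)) +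
        3 * √(n * t / 2) ≤ deviation μ g x} ≤ ENNReal.ofReal (Real.exp (-t)) := by
  set P := Measure.pi fun _ : Fin n => μ with hP
  set R : (Fin n → Z) → ℝ := fun x => rademacher (fun i k => g i (x k)) with hR
  have habs : ∀ i z, |g i z| ≤ 1 := fun i z =>
    abs_le.2 ⟨by linarith [(h01 i z).1], (h01 i z).2⟩
  have hRm : Measurable R := measurable_rademacher hg
  have hDm : Measurable (deviation μ g : (Fin n → Z) → ℝ) := measurable_deviation μ hg
  have hRb : ∀ x, |R x| ≤ n := fun x => abs_rademacher_le fun i k => habs i (x k)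
  have hDb : ∀ x : Fin n → Z, |deviation μ g x| ≤ n := abs_deviation_le μ hg h01
  -- Treating deviation and complexity together costs only one exceptional event.
  have hsub := hasSubgaussianMGF_of_bounded_differences μ 3 n
    (fun x => deviation μ g x - 2 * R x) (hDm.sub (hRm.const_mul 2))
    ⟨n + 2 * n, fun x => by
      have h1 := abs_le.1 (hDb x)
      have h2 := abs_le.1 (hRb x)
      exact abs_le.2 ⟨by linarith, by linarith⟩⟩
    (fun x i z => by
      have h1 := deviation_update_le μ h01 x i z
      have h2 := rademacher_update_le h01 x i z
      simp only [hR, NNReal.coe_ofNat]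
      linarith)
  have hmean : ∫ x, (deviation μ g x - 2 * R x) ∂P ≤ 0 := by
    rw [integral_sub (integrable_of_abs_le hDm hDb)
      ((integrable_of_abs_le hRm hRb).const_mul 2), integral_const_mul]
    linarith [integral_deviation_le (n := n) μ hg h01]
  have hch := hsub.measure_ge_le (ε := 3 * √(n * t / 2)) (by positivity)
  have hn' : (0 : ℝ) < n := by exact_mod_cast hn
  have hexp : -(3 * √(n * t / 2)) ^ 2 / (2 * ((n * (3 / 2) ^ 2 : ℝ≥0) : ℝ)) = -t := by
    rw [mul_pow, Real.sq_sqrt (by positivity)]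
    push_cast
    field_simp
  rw [hexp] at hch
  calc P _ ≤ P {x | 3 * √(n * t / 2) ≤
        deviation μ g x - 2 * R x - ∫ y, (deviation μ g y - 2 * R y) ∂P} := by
        refine measure_mono fun x hx => ?_
        simp only [Set.mem_ofPred_eq] at hx ⊢
        linarith
    _ ≤ _ := by
        rw [← ofReal_measureReal]
        exact ENNReal.ofReal_le_ofReal hch

/-- A countable family of functions with values in `[0, 1]`, all of whose finite subfamilies have
Rademacher complexity at most `B`, satisfies a uniform deviation bound. -/
theorem measure_exists_deviation_gt_le {g : ℕ → Z → ℝ} (hg : ∀ i, Measurable (g i))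
    (h01 : ∀ i z, g i z ∈ Set.Icc (0 : ℝ) 1) (hn : 1 ≤ n) {t : ℝ} (ht : 0 ≤ t)
    {B : (Fin n → Z) → ℝ}
    (hB : ∀ x m, rademacher (fun (i : Fin (m + 1)) k => g i (x k)) ≤ B x) :
    (Measure.pi fun _ : Fin n => μ) {x | ∃ i, 2 * B x + 3 * √(n * t / 2) <
        ∑ k, (∫ z, g i z ∂μ - g i (x k))} ≤ ENNReal.ofReal (Real.exp (-t)) := by
  set A : ℕ → Set (Fin n → Z) := fun m => {x | ∃ i, i ≤ m ∧ 2 * B x + 3 * √(n * t / 2) <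
        ∑ k, (∫ z, g i z ∂μ - g i (x k))} with hA
  have hmono : Monotone A := fun m m' hm x ⟨i, hi, h⟩ => ⟨i, hi.trans hm, h⟩
  have hU : {x | ∃ i, 2 * B x + 3 * √(n * t / 2) <
        ∑ k, (∫ z, g i z ∂μ - g i (x k))} = ⋃ m, A m := by
    ext x
    simp only [hA, Set.mem_ofPred_eq, Set.mem_iUnion]
    exact ⟨fun ⟨i, h⟩ => ⟨i, i, le_rfl, h⟩, fun ⟨_, i, _, h⟩ => ⟨i, h⟩⟩
  -- Continuity from below holds for outer measures of increasing sets, so no measurability of `B`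
  -- is needed.
  rw [hU, hmono.measure_iUnion]
  refine iSup_le fun m => (measure_mono fun x hx => ?_).trans
    (measure_deviation_gt_le μ (g := fun i : Fin (m + 1) => g i) (fun i => hg i)
      (fun i => h01 i) hn ht)
  obtain ⟨i, hi, h⟩ := hx
  have h2 : _ ≤ deviation μ (fun i : Fin (m + 1) => g i) x :=
    le_ciSup (f := fun i : Fin (m + 1) => ∑ k, (∫ z, g i z ∂μ - g i (x k)))
      (Set.finite_range _).bddAbove ⟨i, Nat.lt_succ_of_le hi⟩
  simp only [Set.mem_ofPred_eq]
  have := hB x m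
  simp only at h2
  linarith

end Symmetrization

/-! ### Massart's lemma and chaining -/

section Chaining

variable {ι : Type*} {n : ℕ}

/-- The optimal parameter is `a = √(2L) / r`. It degenerates for `L = 0`, where `a = x / r²` refutes
`x > 0`. -/
theorem le_mul_sqrt_of_forall_le_div_add {x L r : ℝ} (hL : 0 ≤ L) (hr : 0 < r)
    (h : ∀ a > 0, x ≤ L / a + a * r ^ 2 / 2) : x ≤ r * √(2 * L) := by
  rcases hL.eq_or_lt with rfl | hL
  · by_contra! hx
    simp only [mul_zero, Real.sqrt_zero] at hx
    have h1 := h (x / r ^ 2) (by positivity)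
    field_simp at h1
    linarith [pow_pos hx 2]
  · have hs : 0 < √(2 * L) := by positivity
    have h2 : √(2 * L) ^ 2 = 2 * L := Real.sq_sqrt (by positivity)
    refine (h (√(2 * L) / r) (by positivity)).trans (le_of_eq ?_)
    field_simp
    rw [mul_comm L 2, h2]
    ring

/-- Independence of the signs factors the average into hyperbolic cosines, and `cosh x ≤ exp
(x²/2)`. -/
theorem sum_exp_signs_le (a : ℝ) (w : EuclideanSpace ℝ (Fin n)) :
    (∑ ε : Fin n → Bool, Real.exp (a * ∑ k, rsign (ε k) * w k)) / 2 ^ n ≤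
      Real.exp (a ^ 2 * ‖w‖ ^ 2 / 2) := by
  have h1 : ∀ ε : Fin n → Bool, Real.exp (a * ∑ k, rsign (ε k) * w k) =
      ∏ k, Real.exp (a * (rsign (ε k) * w k)) := fun ε => by
    rw [Finset.mul_sum, Real.exp_sum]
  have h2 := Finset.sum_prod_piFinset (Finset.univ : Finset Bool)
    (fun (k : Fin n) (b : Bool) => Real.exp (a * (rsign b * w k)))
  rw [Fintype.piFinset_univ] at h2
  simp_rw [h1]
  rw [h2, div_le_iff₀ (by positivity), EuclideanSpace.real_norm_sq_eq, Finset.mul_sum,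
    Finset.sum_div, Real.exp_sum]
  calc ∏ k, ∑ b, Real.exp (a * (rsign b * w k))
      ≤ ∏ k, (Real.exp (a ^ 2 * w k ^ 2 / 2) * 2) := by
        refine Finset.prod_le_prod (fun k _ => by positivity) fun k _ => ?_
        have := Real.cosh_le_exp_half_sq (a * w k)
        rw [Real.cosh_eq, mul_pow] at this
        simp only [Fintype.sum_bool, rsign]
        simp only [if_true, Bool.false_eq_true, if_false, one_mul, neg_one_mul, mul_neg]
        linarith
    _ = _ := by rw [Finset.prod_mul_distrib]; simp

/-- **Massart's lemma.** -/
theorem rademacher_le_of_norm_le [Fintype ι] [Nonempty ι] [DecidableEq (EuclideanSpace ℝ (Fin n))]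
    (u : ι → EuclideanSpace ℝ (Fin n)) {r L : ℝ} (hr : 0 < r) (hL : 0 ≤ L)
    (hu : ∀ i, ‖u i‖ ≤ r) (hcard : ((Finset.univ.image u).card : ℝ) ≤ Real.exp L) :
    rademacher (fun i k => u i k) ≤ r * √(2 * L) := by
  refine le_mul_sqrt_of_forall_le_div_add hL hr fun a ha => ?_
  have key : Real.exp (a * rademacher (fun i k => u i k)) ≤ Real.exp (L + a ^ 2 * r ^ 2 / 2) := by
    calc Real.exp (a * rademacher (fun i k => u i k))
        ≤ (∑ ε : Fin n → Bool, Real.exp (a * ⨆ i, ∑ k, rsign (ε k) * u i k)) / 2 ^ n := by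
          have := convexOn_exp.map_sum_le (t := (Finset.univ : Finset (Fin n → Bool)))
            (w := fun _ => 1 / 2 ^ n) (p := fun ε => a * ⨆ i, ∑ k, rsign (ε k) * u i k)
            (fun _ _ => by positivity) (by simp) (fun _ _ => Set.mem_univ _)
          simp only [smul_eq_mul, ← Finset.mul_sum] at this
          rw [rademacher]
          refine le_trans (le_of_eq ?_) (this.trans (le_of_eq ?_)) <;> ring_nf
      -- The sum runs over distinct vectors, so repeated indices do not count; in chaining many
      -- indices share one increment.
      _ ≤ (∑ ε : Fin n → Bool, ∑ w ∈ Finset.univ.image u,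
            Real.exp (a * ∑ k, rsign (ε k) * w k)) / 2 ^ n := by
          gcongr with ε
          obtain ⟨i, hi⟩ := exists_eq_ciSup_of_finite (f := fun i => ∑ k, rsign (ε k) * u i k)
          rw [← hi]
          exact Finset.single_le_sum (f := fun w : EuclideanSpace ℝ (Fin n) =>
              Real.exp (a * ∑ k, rsign (ε k) * w k)) (fun _ _ => (Real.exp_pos _).le)
            (Finset.mem_image_of_mem u (Finset.mem_univ i))
      _ = ∑ w ∈ Finset.univ.image u,
            (∑ ε : Fin n → Bool, Real.exp (a * ∑ k, rsign (ε k) * w k)) / 2 ^ n := by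
          rw [Finset.sum_comm, Finset.sum_div]
      _ ≤ ∑ _w ∈ Finset.univ.image u, Real.exp (a ^ 2 * r ^ 2 / 2) := by
          refine Finset.sum_le_sum fun w hw => (sum_exp_signs_le a w).trans ?_
          obtain ⟨i, -, rfl⟩ := Finset.mem_image.1 hw
          gcongr
          exact hu i
      _ ≤ Real.exp (L + a ^ 2 * r ^ 2 / 2) := by
          rw [Finset.sum_const, nsmul_eq_mul, Real.exp_add]
          gcongr
  rw [Real.exp_le_exp] at key
  rw [← mul_le_mul_iff_right₀ ha]
  refine key.trans (le_of_eq ?_)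
  field_simp

theorem rademacher_add_le [Finite ι] [Nonempty ι] (v w : ι → Fin n → ℝ) :
    rademacher (fun i k => v i k + w i k) ≤ rademacher v + rademacher w := by
  unfold rademacher
  rw [← add_div, ← Finset.sum_add_distrib]
  gcongr with ε
  refine ciSup_le fun i => ?_
  simp only [mul_add, Finset.sum_add_distrib]
  exact add_le_add
    (le_ciSup (f := fun i => ∑ k, rsign (ε k) * v i k) (Set.finite_range _).bddAbove i)
    (le_ciSup (f := fun i => ∑ k, rsign (ε k) * w i k) (Set.finite_range _).bddAbove i)

theorem rademacher_le_sqrt_mul [Finite ι] [Nonempty ι] (u : ι → EuclideanSpace ℝ (Fin n)) {r : ℝ}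
    (hu : ∀ i, ‖u i‖ ≤ r) : rademacher (fun i k => u i k) ≤ √n * r := by
  unfold rademacher
  rw [← sum_signs_const n (√n * r)]
  gcongr with ε
  refine ciSup_le fun i => (Real.sum_mul_le_sqrt_mul_sqrt _ _ _).trans ?_
  have : ∀ k, rsign (ε k) ^ 2 = 1 := fun k => by rw [← sq_abs, abs_rsign, one_pow]
  simp only [this]
  have h := hu i
  rw [EuclideanSpace.norm_eq] at h
  simp only [Real.norm_eq_abs, sq_abs] at h
  simpa using mul_le_mul_of_nonneg_left h (Real.sqrt_nonneg n)

/-- A discrete form of Dudley's entropy bound. -/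
theorem rademacher_le_chaining [Finite ι] [Nonempty ι] (hn : 1 ≤ n)
    (v : ι → EuclideanSpace ℝ (Fin n)) (hv : ∀ i, ‖v i‖ ≤ √n) {m : ℕ → ℝ} (hm : Monotone m)
    (hm0 : 0 ≤ m 0)
    (hT : ∀ j, ∃ T : Finset (EuclideanSpace ℝ (Fin n)), (T.card : ℝ) ≤ Real.exp (m j) ∧
      ∀ i, ∃ w ∈ T, ‖v i - w‖ ≤ √n * (1 / 2) ^ j) (J : ℕ) :
    rademacher (fun i k => v i k) ≤
      n * (1 / 2) ^ J + 6 * √n * ∑ j ∈ Finset.range J, (1 / 2) ^ (j + 1) * √(m (j + 1)) := by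
  classical
  have : Fintype ι := Fintype.ofFinite ι
  have hn' : (0 : ℝ) < √n := by
    rw [Real.sqrt_pos]
    exact_mod_cast hn
  -- At scale 0 the given net is replaced by `{0}`, admissible because all vectors have norm at most
  -- `√n`; the telescoping sum then starts at zero.
  have hT' : ∀ j, ∃ (T : Finset (EuclideanSpace ℝ (Fin n))) (π : ι → EuclideanSpace ℝ (Fin n)),
      (T.card : ℝ) ≤ Real.exp (m j) ∧ (∀ i, π i ∈ T) ∧ (∀ i, ‖v i - π i‖ ≤ √n * (1 / 2) ^ j) ∧
        (j = 0 → π = 0) := by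
    intro j
    rcases j with _ | j
    · exact ⟨{0}, 0, by simpa using hm0, by simp, by simpa using hv, fun _ => rfl⟩
    · obtain ⟨T, hc, h⟩ := hT (j + 1)
      choose π hπ using h
      exact ⟨T, π, hc, fun i => (hπ i).1, fun i => (hπ i).2, by simp⟩
  choose T π hc hπ hd h0 using hT'
  have hmn : ∀ j, 0 ≤ m j := fun j => hm0.trans (hm (Nat.zero_le j))
  -- Radii `2^(-j)` and `2^(-j-1)` add up to `3 * 2^(-j-1)`, and at most `exp (2 m (j+1))`
  -- increments occur; Massart's lemma then gives `3 * 2 = 6`.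
  have hinc : ∀ j, rademacher (fun i k => (π (j + 1) i - π j i) k) ≤
      6 * √n * ((1 / 2) ^ (j + 1) * √(m (j + 1))) := by
    intro j
    refine (rademacher_le_of_norm_le (fun i => π (j + 1) i - π j i)
      (r := 3 * (√n * (1 / 2) ^ (j + 1))) (L := m (j + 1) + m (j + 1)) (by positivity)
      (add_nonneg (hmn _) (hmn _)) (fun i => ?_) ?_).trans (le_of_eq ?_)
    · have h1 : π (j + 1) i - π j i = (v i - π j i) - (v i - π (j + 1) i) := by abel
      rw [h1]
      refine (norm_sub_le _ _).trans ((add_le_add (hd j i) (hd (j + 1) i)).trans (le_of_eq ?_))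
      rw [pow_succ]
      ring
    · have hsub : Finset.univ.image (fun i => π (j + 1) i - π j i) ⊆
          (T (j + 1) ×ˢ T j).image fun q => q.1 - q.2 := by
        intro w hw
        obtain ⟨i, -, rfl⟩ := Finset.mem_image.1 hw
        exact Finset.mem_image.2 ⟨(π (j + 1) i, π j i),
          Finset.mem_product.2 ⟨hπ _ i, hπ _ i⟩, rfl⟩
      have h1 := (Finset.card_le_card hsub).trans Finset.card_image_le
      rw [Finset.card_product] at h1
      calc _ ≤ ((T (j + 1)).card : ℝ) * (T j).card := by exact_mod_cast h1
        _ ≤ Real.exp (m (j + 1)) * Real.exp (m (j + 1)) := by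
          gcongr
          · exact hc _
          · exact (hc j).trans (Real.exp_le_exp.2 (hm (Nat.le_succ j)))
        _ = _ := (Real.exp_add _ _).symm
    · rw [show 2 * (m (j + 1) + m (j + 1)) = 2 ^ 2 * m (j + 1) by ring,
        Real.sqrt_mul (by positivity), Real.sqrt_sq (by positivity)]
      ring
  have hsum : ∀ J, rademacher (fun i k => π J i k) ≤
      ∑ j ∈ Finset.range J, 6 * √n * ((1 / 2) ^ (j + 1) * √(m (j + 1))) := by
    intro J
    induction J with
    | zero => simp [h0 0 rfl, rademacher]
    | succ J ih =>
      rw [Finset.sum_range_succ]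
      have := rademacher_add_le (fun i k => π J i k) (fun i k => (π (J + 1) i - π J i) k)
      simp only [PiLp.sub_apply, add_sub_cancel] at this
      exact this.trans (add_le_add ih (hinc J))
  have hlast := rademacher_add_le (fun i k => (v i - π J i) k) (fun i k => π J i k)
  simp only [PiLp.sub_apply, sub_add_cancel] at hlast
  refine hlast.trans (add_le_add ?_ ?_)
  · have := rademacher_le_sqrt_mul (fun i => v i - π J i) (hd J)
    simp only [PiLp.sub_apply] at this
    rwa [← mul_assoc, Real.mul_self_sqrt (by positivity)] at this
  · rw [Finset.mul_sum]
    exact hsum J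

/-- From `log n ≤ H_{n-1}` and `log 2 > 1/2`; this counts the chaining scales. -/
theorem natLog_sub_one_le_two_mul_harmonic (hn : 1 ≤ n) :
    ((Nat.log 2 n - 1 : ℕ) : ℝ) ≤ 2 * ((harmonic (n - 1) : ℚ) : ℝ) := by
  have h1 : Real.log n ≤ ((harmonic (n - 1) : ℚ) : ℝ) := by
    have := log_add_one_le_harmonic (n - 1)
    rwa [Nat.sub_add_cancel hn] at this
  have h2 : (Nat.log 2 n : ℝ) * Real.log 2 ≤ Real.log n := by
    rw [← Real.log_pow]
    refine Real.log_le_log (by positivity) ?_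
    exact_mod_cast Nat.pow_log_le_self 2 (by omega)
  have h3 : ((Nat.log 2 n - 1 : ℕ) : ℝ) ≤ Nat.log 2 n := by exact_mod_cast Nat.sub_le _ _
  have h4 := Real.log_two_gt_d9
  have h5 : (0 : ℝ) ≤ Nat.log 2 n := by positivity
  nlinarith

theorem mul_half_pow_natLog_le (n : ℕ) : (n : ℝ) * (1 / 2) ^ (Nat.log 2 n - 1) ≤ 4 := by
  have h1 : n < 2 ^ (Nat.log 2 n + 1) := Nat.lt_pow_succ_log_self (by norm_num) n
  have h2 : 2 ^ (Nat.log 2 n + 1) ≤ 4 * 2 ^ (Nat.log 2 n - 1) := by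
    rw [show 4 = 2 ^ 2 by norm_num, ← pow_add]
    exact Nat.pow_le_pow_right (by norm_num) (by omega)
  have h3 : (n : ℝ) ≤ 4 * 2 ^ (Nat.log 2 n - 1) := by exact_mod_cast h1.le.trans h2
  rw [one_div, inv_pow, ← div_eq_mul_inv, div_le_iff₀ (by positivity)]
  exact h3

/-- The entropy bound for a class with logarithmic covering numbers `A² 4^j`. -/
theorem rademacher_le_of_quadratic_entropy [Finite ι] [Nonempty ι] (hn : 1 ≤ n)
    (v : ι → EuclideanSpace ℝ (Fin n)) (hv : ∀ i, ‖v i‖ ≤ √n) {A : ℝ} (hA : 0 ≤ A)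
    (hT : ∀ j : ℕ, ∃ T : Finset (EuclideanSpace ℝ (Fin n)),
      (T.card : ℝ) ≤ Real.exp (A ^ 2 * 4 ^ j) ∧ ∀ i, ∃ w ∈ T, ‖v i - w‖ ≤ √n * (1 / 2) ^ j) :
    rademacher (fun i k => v i k) ≤ 4 + 12 * √n * A * ((harmonic (n - 1) : ℚ) : ℝ) := by
  refine (rademacher_le_chaining hn v hv (m := fun j => A ^ 2 * 4 ^ j) (fun i j hij => ?_)
    (by positivity) hT (Nat.log 2 n - 1)).trans (add_le_add (mul_half_pow_natLog_le n) ?_)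
  · simp only
    gcongr
    norm_num
  · have h : ∀ j : ℕ, (1 / 2 : ℝ) ^ (j + 1) * √(A ^ 2 * 4 ^ (j + 1)) = A := fun j => by
      rw [show (4 : ℝ) = 2 ^ 2 by norm_num, ← pow_mul, mul_comm 2, pow_mul, ← mul_pow,
        Real.sqrt_sq (by positivity), mul_left_comm, ← mul_pow]
      norm_num
    simp only [h, Finset.sum_const, Finset.card_range, nsmul_eq_mul]
    have := natLog_sub_one_le_two_mul_harmonic hn
    have h2 : 0 ≤ 6 * √n * A := by positivity
    nlinarith [mul_le_mul_of_nonneg_left this h2]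

theorem sum_half_pow_mul_le (J : ℕ) :
    (∑ j ∈ Finset.range J, (1 / 2 : ℝ) ^ (j + 1) ≤ 1) ∧
      ∑ j ∈ Finset.range J, (1 / 2 : ℝ) ^ (j + 1) * (j + 1) ≤ 2 := by
  have h1 : ∑ j ∈ Finset.range J, (1 / 2 : ℝ) ^ (j + 1) = 1 - (1 / 2) ^ J := by
    induction J with
    | zero => simp
    | succ J ih => rw [Finset.sum_range_succ, ih, pow_succ]; ring
  have h2 : ∑ j ∈ Finset.range J, (1 / 2 : ℝ) ^ (j + 1) * (j + 1) = 2 - (J + 2) * (1 / 2) ^ J := by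
    induction J with
    | zero => simp
    | succ J ih =>
      rw [Finset.sum_range_succ, ih (by
        rw [Finset.sum_range_succ, pow_succ] at h1
        linarith), pow_succ]
      push_cast
      ring
  rw [h1, h2]
  exact ⟨sub_le_self _ (by positivity), sub_le_self _ (by positivity)⟩

/-- The entropy bound for a class with summable weighted logarithmic covering numbers. -/
theorem rademacher_le_of_summable_entropy [Finite ι] [Nonempty ι] (hn : 1 ≤ n)
    (v : ι → EuclideanSpace ℝ (Fin n)) (hv : ∀ i, ‖v i‖ ≤ √n) {m : ℕ → ℝ} (hm : Monotone m)
    (hm0 : 0 ≤ m 0)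
    (hT : ∀ j, ∃ T : Finset (EuclideanSpace ℝ (Fin n)), (T.card : ℝ) ≤ Real.exp (m j) ∧
      ∀ i, ∃ w ∈ T, ‖v i - w‖ ≤ √n * (1 / 2) ^ j) {V : ℝ}
    (hV : ∀ J, ∑ j ∈ Finset.range J, (1 / 2) ^ (j + 1) * m (j + 1) ≤ 4 * V) :
    rademacher (fun i k => v i k) ≤ 12 * √n * √V := by
  have hmn : ∀ j, 0 ≤ m j := fun j => hm0.trans (hm (Nat.zero_le j))
  have hJ : ∀ J, ∑ j ∈ Finset.range J, (1 / 2 : ℝ) ^ (j + 1) * √(m (j + 1)) ≤ 2 * √V := by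
    intro J
    have h2 : 2 * √V = √(4 * V) := by
      rw [show (4 : ℝ) = 2 ^ 2 by norm_num, Real.sqrt_mul (by positivity),
        Real.sqrt_sq (by positivity)]
    rw [h2]
    refine Real.le_sqrt_of_sq_le (le_trans ?_ (hV J))
    -- Cauchy-Schwarz with weights `2^(-j-1)` of total mass at most 1 moves the square root outside
    -- the sum.
    have hcs := Finset.sum_mul_sq_le_sq_mul_sq (Finset.range J)
      (fun j => √((1 / 2 : ℝ) ^ (j + 1))) (fun j => √((1 / 2 : ℝ) ^ (j + 1) * m (j + 1)))
    have e1 : ∀ j, √((1 / 2 : ℝ) ^ (j + 1)) * √((1 / 2 : ℝ) ^ (j + 1) * m (j + 1)) =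
        (1 / 2 : ℝ) ^ (j + 1) * √(m (j + 1)) := fun j => by
      rw [Real.sqrt_mul (by positivity), ← mul_assoc, Real.mul_self_sqrt (by positivity)]
    have e2 : ∀ j, √((1 / 2 : ℝ) ^ (j + 1)) ^ 2 = (1 / 2 : ℝ) ^ (j + 1) := fun j =>
      Real.sq_sqrt (by positivity)
    have e3 : ∀ j, √((1 / 2 : ℝ) ^ (j + 1) * m (j + 1)) ^ 2 = (1 / 2 : ℝ) ^ (j + 1) * m (j + 1) :=
      fun j => Real.sq_sqrt (mul_nonneg (by positivity) (hmn _))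
    simp only [e1, e2, e3] at hcs
    refine hcs.trans (mul_le_of_le_one_left (Finset.sum_nonneg fun j _ =>
      mul_nonneg (by positivity) (hmn _)) (sum_half_pow_mul_le J).1)
  -- The entropy sum is bounded uniformly in `J`, so chaining continues to all scales and the
  -- truncation error vanishes.
  have hlim : Filter.Tendsto (fun J : ℕ => (n : ℝ) * (1 / 2) ^ J + 12 * √n * √V) Filter.atTop
      (nhds (n * 0 + 12 * √n * √V)) :=
    ((tendsto_pow_atTop_nhds_zero_of_lt_one (by norm_num) (by norm_num)).const_mul _).add_const _
  rw [mul_zero, zero_add] at hlim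
  refine ge_of_tendsto' hlim fun J => (rademacher_le_chaining hn v hv hm hm0 hT J).trans ?_
  have := mul_le_mul_of_nonneg_left (hJ J) (by positivity : 0 ≤ 6 * √(n : ℝ))
  linarith

end Chaining

/-! ### The function `ψ` -/

theorem le_hurwitz {q : ℝ} (hq : 1 ≤ q) : 1 / q ^ (3 / 2 : ℝ) ≤ hurwitz (3 / 2) q := by
  have hs : Summable fun m : ℕ => 1 / (q + m) ^ (3 / 2 : ℝ) := by
    have h1 : Summable fun m : ℕ => 1 / ((m + 1 : ℕ) : ℝ) ^ (3 / 2 : ℝ) :=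
      (summable_nat_add_iff 1).2 (Real.summable_one_div_nat_rpow.2 (by norm_num))
    refine Summable.of_nonneg_of_le (fun m => by positivity) (fun m => ?_) h1
    push_cast
    exact one_div_le_one_div_of_le (by positivity)
      (Real.rpow_le_rpow (by positivity) (by linarith) (by norm_num))
  have := hs.le_tsum 0 fun m _ => by positivity
  simpa [hurwitz] using this

/-- The first term of each zeta series suffices: `1 + 1/a ≤ 2`, and `(2^(-3/2))^(2/3) = 1/2`. This
lower bound is all that is used about `psi` at positive arguments. -/
theorem half_le_psi {a : ℝ} (ha : 1 ≤ a) : 1 / 2 ≤ psi a := by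
  have ha0 : 0 < a := by linarith
  rw [psi, if_neg ha0.ne']
  have h1 : (1 : ℝ) ≤ hurwitz (3 / 2) 1 := by simpa using le_hurwitz le_rfl
  have h2 : (1 / 2 : ℝ) ^ (3 / 2 : ℝ) ≤ hurwitz (3 / 2) (1 + 1 / a) := by
    refine le_trans ?_ (le_hurwitz (by simpa using ha0.le))
    rw [Real.div_rpow (by norm_num) (by norm_num), Real.one_rpow]
    have : 1 / a ≤ 1 := by rw [div_le_one ha0]; exact ha
    gcongr
    linarith
  calc (1 / 2 : ℝ) = 1 ^ (1 / 3 : ℝ) * ((1 / 2) ^ (3 / 2 : ℝ)) ^ (2 / 3 : ℝ) := by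
        rw [Real.one_rpow, ← Real.rpow_mul (by norm_num)]
        norm_num
    _ ≤ _ := by gcongr

/-- Since `1 + 4^i a ≤ 4^i (1 + a)`, the sum is at most `log (1 + a) + 4 log 2`; the excess is
absorbed by `log (1 + a) ≥ log 2` and `psi a ≥ 1/2`. At `a = 0` both sides vanish. -/
theorem sum_log_one_add_le (a J : ℕ) :
    ∑ j ∈ Finset.range J, (1 / 2 : ℝ) ^ (j + 1) * Real.log (1 + 4 ^ (j + 1) * a) ≤
      4 * (Real.log (1 + a) + psi a) := by
  rcases Nat.eq_zero_or_pos a with rfl | ha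
  · simp [psi]
  have ha' : (1 : ℝ) ≤ a := by exact_mod_cast ha
  have hlog : ∀ j : ℕ, Real.log (1 + 4 ^ (j + 1) * a) ≤
      Real.log (1 + a) + (j + 1) * (2 * Real.log 2) := fun j => by
    have h4 : (2 * Real.log 2) = Real.log 4 := by
      rw [show (4 : ℝ) = 2 ^ 2 by norm_num, Real.log_pow]; norm_num
    rw [h4, ← Nat.cast_succ, ← Real.log_pow, ← Real.log_mul (by positivity) (by positivity)]
    refine Real.log_le_log (by positivity) ?_
    have : (1 : ℝ) ≤ 4 ^ (j + 1) := one_le_pow₀ (by norm_num)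
    simp only [Nat.succ_eq_add_one]
    nlinarith
  obtain ⟨h1, h2⟩ := sum_half_pow_mul_le J
  have hl2 : Real.log 2 ≤ Real.log (1 + a) := Real.log_le_log (by norm_num) (by linarith)
  have hpsi := half_le_psi ha'
  have hl := Real.log_two_lt_d9
  have hl' := Real.log_two_gt_d9
  calc _ ≤ ∑ j ∈ Finset.range J, ((1 / 2 : ℝ) ^ (j + 1) * Real.log (1 + a) +
        (1 / 2 : ℝ) ^ (j + 1) * (j + 1) * (2 * Real.log 2)) := by
        refine Finset.sum_le_sum fun j _ => ?_
        rw [mul_assoc, ← mul_add]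
        exact mul_le_mul_of_nonneg_left (hlog j) (by positivity)
    _ = (∑ j ∈ Finset.range J, (1 / 2 : ℝ) ^ (j + 1)) * Real.log (1 + a) +
        (∑ j ∈ Finset.range J, (1 / 2 : ℝ) ^ (j + 1) * (j + 1)) * (2 * Real.log 2) := by
        rw [Finset.sum_add_distrib, Finset.sum_mul, Finset.sum_mul]
    _ ≤ 1 * Real.log (1 + a) + 2 * (2 * Real.log 2) := by
        gcongr
        linarith
    _ ≤ _ := by linarith

/-! ### Sparsification -/

section Maurey

variable {E : Type*} [NormedAddCommGroup E] [InnerProductSpace ℝ E]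

/-- A greedy form of Maurey's sparsification lemma: if `y` is in the closed convex hull of vectors
of norm at most `a`, then it is within `a / √k` of an average of `k` of them. -/
theorem exists_norm_sum_sub_le {σ : Type*} {v : σ → E} {y : E} {a : ℝ} (hv : ∀ i, ‖v i‖ ≤ a)
    (hy : ∀ z : E, ∃ i, inner ℝ z (v i) ≤ inner ℝ z y) (k : ℕ) :
    ∃ s : Fin k → σ, ‖∑ i, v (s i) - (k : ℝ) • y‖ ^ 2 ≤ k * a ^ 2 := by
  induction k with
  | zero => exact ⟨Fin.elim0, by simp⟩
  | succ k ih =>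
    obtain ⟨s, hs⟩ := ih
    set S := ∑ i, v (s i) - (k : ℝ) • y with hS
    -- This choice makes the cross term at most `2⟨S - y, y⟩`, so the squared error grows by at most
    -- `‖v i‖² - ‖y‖² ≤ a²`.
    obtain ⟨i, hi⟩ := hy (S - y)
    refine ⟨Fin.snoc s i, ?_⟩
    have h1 : ∑ j, v ((Fin.snoc s i : Fin (k + 1) → σ) j) - ((k + 1 : ℕ) : ℝ) • y =
        (S - y) + v i := by
      rw [Fin.sum_univ_castSucc]
      simp only [Fin.snoc_castSucc, Fin.snoc_last, hS, Nat.cast_add, Nat.cast_one, add_smul,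
        one_smul]
      abel
    have h2 : ‖v i‖ ^ 2 ≤ a ^ 2 := pow_le_pow_left₀ (norm_nonneg _) (hv i) 2
    have h3 := norm_sub_sq_real S y
    have h4 : inner ℝ (S - y) y = inner ℝ S y - ‖y‖ ^ 2 := by
      rw [inner_sub_left, real_inner_self_eq_norm_sq]
    rw [h1, norm_add_sq_real, h3]
    push_cast
    nlinarith [sq_nonneg ‖y‖]

/-- The combinations `∑ c_t u_t` with `∑ |c_t| ‖u_t‖ ≤ a` have a cover of radius `a / √k` whose
cardinality is bounded in two ways. -/
theorem exists_cover_of_sum_le {τ : Type*} [Fintype τ] (u : τ → E) {a : ℝ} (ha : 0 ≤ a) (k : ℕ) :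
    ∃ C : Finset E, C.card ≤ max 1 (2 * Fintype.card τ) ^ k ∧
      C.card ≤ (k + 1) ^ (2 * Fintype.card τ) ∧
      ∀ c : τ → ℝ, ∑ t, |c t| * ‖u t‖ ≤ a →
        ∃ w ∈ C, ‖∑ t, c t • u t - w‖ ≤ a / √(max k 1 : ℕ) := by
  classical
  have htriv : ∀ c : τ → ℝ, ∑ t, |c t| * ‖u t‖ ≤ a → ‖∑ t, c t • u t‖ ≤ a := fun c hc =>
    (norm_sum_le _ _).trans (by simpa [norm_smul] using hc)
  rcases Nat.eq_zero_or_pos k with rfl | hk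
  · exact ⟨{0}, by simp, by simp, fun c hc => ⟨0, by simp, by simpa using htriv c hc⟩⟩
  rcases isEmpty_or_nonempty τ with hτ | hτ
  · exact ⟨{0}, by simp, by simp, fun c hc => ⟨0, by simp, by simp; positivity⟩⟩
  have hk' : (0 : ℝ) < k := by exact_mod_cast hk
  -- The atoms are `±u_t` rescaled to norm `a`; for `u_t = 0` they are zero. The admissible
  -- combinations lie in their convex hull.
  set v : τ × Bool → E := fun q => rsign q.2 • (a / ‖u q.1‖) • u q.1 with hv
  set f : (Fin k → τ × Bool) → E := fun s => (k : ℝ)⁻¹ • ∑ i, v (s i) with hf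
  refine ⟨Finset.univ.image f, ?_, ?_, fun c hc => ?_⟩
  · refine Finset.card_image_le.trans ?_
    simp only [Finset.card_univ, Fintype.card_fun, Fintype.card_prod, Fintype.card_bool,
      Fintype.card_fin]
    rw [mul_comm]
    exact Nat.pow_le_pow_left (le_max_right _ _) k
  -- An average depends only on how often each of the `2|τ|` atoms occurs.
  · have hsub : Finset.univ.image f ⊆ Finset.univ.image
        fun m : τ × Bool → Fin (k + 1) => (k : ℝ)⁻¹ • ∑ q, (m q : ℕ) • v q := by
      intro w hw
      obtain ⟨s, -, rfl⟩ := Finset.mem_image.1 hw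
      refine Finset.mem_image.2 ⟨fun q => ⟨(Finset.univ.filter fun i => s i = q).card,
        Nat.lt_succ_of_le ((Finset.card_le_univ _).trans (by simp))⟩, Finset.mem_univ _, ?_⟩
      simp only [hf]
      rw [← Finset.sum_fiberwise Finset.univ s]
      congr 1
      refine Finset.sum_congr rfl fun q _ => ?_
      rw [← Finset.sum_const]
      refine Finset.sum_congr rfl fun i hi => ?_
      rw [(Finset.mem_filter.1 hi).2]
    refine (Finset.card_le_card hsub).trans (Finset.card_image_le.trans ?_)
    simp [mul_comm]
  · have hvn : ∀ q, ‖v q‖ ≤ a := fun q => by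
      simp only [hv, norm_smul, Real.norm_eq_abs, abs_rsign, one_mul, abs_div, abs_norm,
        abs_of_nonneg ha]
      rcases (norm_nonneg (u q.1)).eq_or_lt with h | h
      · simp [← h, ha]
      · rw [div_mul_cancel₀ _ h.ne']
    -- Hull membership is tested by linear functionals: the least value of `⟨z, ·⟩` on the atoms is
    -- `-M`, while the weight constraint bounds it by `M` in absolute value at the combination.
    have hy : ∀ z : E, ∃ q, inner ℝ z (v q) ≤ inner ℝ z (∑ t, c t • u t) := by
      intro z
      obtain ⟨t₀, ht₀⟩ := Finite.exists_max fun t => |(a / ‖u t‖) * inner ℝ z (u t)|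
      set M := |(a / ‖u t₀‖) * inner ℝ z (u t₀)| with hM
      have hM0 : 0 ≤ M := abs_nonneg _
      have h1 : -M ≤ inner ℝ z (∑ t, c t • u t) := by
        rw [inner_sum]
        refine (abs_le.1 ((Finset.abs_sum_le_sum_abs _ _).trans ?_)).1
        rcases ha.eq_or_lt with rfl | ha
        · have h0 : ∀ t, |c t| * ‖u t‖ = 0 := fun t =>
            le_antisymm ((Finset.single_le_sum (f := fun t => |c t| * ‖u t‖)
              (fun _ _ => by positivity) (Finset.mem_univ t)).trans hc) (by positivity)
          refine (Finset.sum_nonpos fun t _ => ?_).trans hM0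
          rw [inner_smul_right, abs_mul]
          nlinarith [abs_real_inner_le_norm z (u t), h0 t, abs_nonneg (c t), norm_nonneg z,
            mul_le_mul_of_nonneg_left (abs_real_inner_le_norm z (u t)) (abs_nonneg (c t))]
        · calc ∑ t, |inner ℝ z (c t • u t)| ≤ ∑ t, |c t| * ‖u t‖ * (M / a) := by
                refine Finset.sum_le_sum fun t _ => ?_
                rw [inner_smul_right, abs_mul, mul_assoc]
                refine mul_le_mul_of_nonneg_left ?_ (abs_nonneg _)
                rcases (norm_nonneg (u t)).eq_or_lt with h | h
                · rw [norm_eq_zero.1 h.symm]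
                  simp
                · have := ht₀ t
                  rw [abs_mul, abs_of_pos (div_pos ha h), div_mul_eq_mul_div, div_le_iff₀ h]
                    at this
                  rw [← mul_div_assoc, le_div_iff₀ ha]
                  linarith
            _ ≤ a * (M / a) := by
                rw [← Finset.sum_mul]
                gcongr
            _ = M := by field_simp
      have h2 : ∃ b, inner ℝ z (v (t₀, b)) = -M := by
        simp only [hv, inner_smul_right]
        rcases abs_cases ((a / ‖u t₀‖) * inner ℝ z (u t₀)) with h | h
        · exact ⟨false, by simp [rsign, hM, h.1]⟩
        · exact ⟨true, by simp [rsign, hM, h.1]⟩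
      obtain ⟨b, hb⟩ := h2
      exact ⟨(t₀, b), hb.trans_le h1⟩
    obtain ⟨s, hs⟩ := exists_norm_sum_sub_le hvn hy k
    refine ⟨f s, Finset.mem_image_of_mem f (Finset.mem_univ s), ?_⟩
    have h1 : ∑ t, c t • u t - f s = (-(k : ℝ)⁻¹) • (∑ i, v (s i) - (k : ℝ) • ∑ t, c t • u t) := by
      simp only [hf, smul_sub, neg_smul, smul_smul, inv_mul_cancel₀ hk'.ne', one_smul, neg_mul]
      abel
    rw [max_eq_left hk, h1, norm_smul, norm_neg, norm_inv, Real.norm_natCast]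
    have h2 := Real.le_sqrt_of_sq_le hs
    rw [Real.sqrt_mul hk'.le, Real.sqrt_sq ha] at h2
    rw [inv_mul_le_iff₀ hk']
    refine h2.trans (le_of_eq ?_)
    have h3 : (k : ℝ) = √k * √k := (Real.mul_self_sqrt hk'.le).symm
    have h4 : 0 < √(k : ℝ) := Real.sqrt_pos.2 hk'
    rw [mul_div_assoc', eq_div_iff h4.ne', mul_right_comm, ← h3]

end Maurey

/-! ### Layers as linear functions of their parameters -/

theorem dataNorm_eq_norm {p : Shape} {n : ℕ} (X : Fin n → p.Space) :
    Net.dataNorm X = ‖(WithLp.toLp 2 X : PiLp 2 fun _ : Fin n => p.Space)‖ := by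
  rw [Net.dataNorm, PiLp.norm_eq_of_L2]

theorem dataNorm_nonneg {p : Shape} {n : ℕ} (X : Fin n → p.Space) : 0 ≤ Net.dataNorm X :=
  Real.sqrt_nonneg _

theorem dataNorm_sq {p : Shape} {n : ℕ} (X : Fin n → p.Space) :
    Net.dataNorm X ^ 2 = ∑ k, ‖X k‖ ^ 2 :=
  Real.sq_sqrt (by positivity)

/-- Cauchy-Schwarz for features `φ_r` with `∑_r ‖φ_r(x)‖² ≤ ‖x‖²`. -/
theorem sum_abs_mul_dataNorm_le {p q : Shape} {ρ : Type*} [Fintype ρ]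
    {φ : ρ → p.Space → q.Space} (hφ : ∀ x, ∑ r, ‖φ r x‖ ^ 2 ≤ ‖x‖ ^ 2) (c : ρ → ℝ) {n : ℕ}
    (X : Fin n → p.Space) :
    ∑ r, |c r| * Net.dataNorm (fun k => φ r (X k)) ≤ √(∑ r, c r ^ 2) * Net.dataNorm X := by
  refine (Real.sum_mul_le_sqrt_mul_sqrt _ _ _).trans ?_
  simp only [sq_abs, dataNorm_sq]
  rw [Finset.sum_comm]
  exact mul_le_mul_of_nonneg_left (Real.sqrt_le_sqrt (Finset.sum_le_sum fun k _ => hφ (X k)))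
    (Real.sqrt_nonneg _)

theorem zeroPad_sq {c h w : ℕ} (x : (Shape.img c h w).Space) (r : Fin c) (u v : ℤ) :
    zeroPad x r u v ^ 2 = ∑ u' : Fin h, ∑ v' : Fin w,
      if ((u' : ℕ) : ℤ) = u ∧ ((v' : ℕ) : ℤ) = v then x (r, u', v') ^ 2 else 0 := by
  unfold zeroPad
  split_ifs with huv
  · rw [Finset.sum_eq_single ⟨u.toNat, by omega⟩, Finset.sum_eq_single ⟨v.toNat, by omega⟩]
    · rw [if_pos ⟨by simp; omega, by simp; omega⟩]
    · intro v' _ hv'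
      rw [if_neg]
      rintro ⟨_, h⟩
      exact hv' (Fin.ext (by simp; omega))
    · simp
    · intro u' _ hu'
      refine Finset.sum_eq_zero fun v' _ => if_neg ?_
      rintro ⟨h, _⟩
      exact hu' (Fin.ext (by simp; omega))
    · simp
  · symm
    rw [zero_pow two_ne_zero]
    refine Finset.sum_eq_zero fun u' _ => Finset.sum_eq_zero fun v' _ => if_neg ?_
    rintro ⟨h1, h2⟩
    exact huv ⟨⟨by omega, by omega⟩, ⟨by omega, by omega⟩⟩

/-- For a fixed kernel offset, injective position maps read each pixel at most once; positive
strides provide the injectivity. -/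
theorem sum_zeroPad_sq_le {c h w h' w' : ℕ} (x : (Shape.img c h w).Space) {f : Fin h' → ℤ}
    {g : Fin w' → ℤ} (hf : Function.Injective f) (hg : Function.Injective g) :
    ∑ r, ∑ o : Fin h' × Fin w', zeroPad x r (f o.1) (g o.2) ^ 2 ≤ ‖x‖ ^ 2 := by
  rw [EuclideanSpace.real_norm_sq_eq]
  change _ ≤ ∑ i : Fin c × Fin h × Fin w, x i ^ 2
  rw [Fintype.sum_prod_type]
  refine Finset.sum_le_sum fun r _ => ?_
  simp only [zeroPad_sq]
  rw [Finset.sum_comm, Fintype.sum_prod_type]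
  refine Finset.sum_le_sum fun u _ => ?_
  rw [Finset.sum_comm]
  refine Finset.sum_le_sum fun v _ => ?_
  rw [← Finset.sum_filter, Finset.sum_const, nsmul_eq_mul]
  refine mul_le_of_le_one_left (sq_nonneg _) ?_
  have : (Finset.univ.filter fun o : Fin h' × Fin w' =>
      ((u : ℕ) : ℤ) = f o.1 ∧ ((v : ℕ) : ℤ) = g o.2).card ≤ 1 := by
    rw [Finset.card_le_one]
    intro o ho o' ho'
    have h1 := (Finset.mem_filter.1 ho).2
    have h2 := (Finset.mem_filter.1 ho').2
    exact Prod.ext (hf (h1.1.symm.trans h2.1)) (hg (h1.2.symm.trans h2.2))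
  exact_mod_cast this

theorem Layer.map_zero {p q : Shape} (l : Layer p q) (w : l.Weight) : l.map w 0 = 0 := by
  cases l with
  | fc p q =>
    exact congrArg (WithLp.toLp 2)
      (Matrix.mulVec_zero (show Matrix q.Idx p.Idx ℝ from w))
  | conv cin cout h w kh kw sh sw hsh hsw =>
    ext o
    simp [Layer.map, ResNet.conv, zeroPad]

/-- The difference of the maps that a layer computes with two weights is a combination of fixed
features whose coefficients are controlled by the `(2,1)` distance of the weights. -/
theorem Layer.exists_features {p q : Shape} (l : Layer p q) :
    ∃ φ : Fin l.numParams → p.Space → q.Space, ∀ w w₀ : l.Weight, ∃ c : Fin l.numParams → ℝ,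
      (∀ x, l.map w x - l.map w₀ x = ∑ t, c t • φ t x) ∧
      ∀ (n : ℕ) (X : Fin n → p.Space),
        ∑ t, |c t| * Net.dataNorm (fun k => φ t (X k)) ≤ l.dist21 w w₀ * Net.dataNorm X := by
  classical
  suffices H : ∃ (τ : Type) (_ : Fintype τ) (_ : Fintype.card τ = l.numParams)
      (φ : τ → p.Space → q.Space), ∀ w w₀ : l.Weight, ∃ c : τ → ℝ,
      (∀ x, l.map w x - l.map w₀ x = ∑ t, c t • φ t x) ∧
      ∀ (n : ℕ) (X : Fin n → p.Space),
        ∑ t, |c t| * Net.dataNorm (fun k => φ t (X k)) ≤ l.dist21 w w₀ * Net.dataNorm X by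
    obtain ⟨τ, _, hτ, φ, h⟩ := H
    let e := (Fintype.equivFinOfCardEq hτ).symm
    refine ⟨fun t => φ (e t), fun w w₀ => ?_⟩
    obtain ⟨c, hc, hc'⟩ := h w w₀
    refine ⟨fun t => c (e t), fun x => ?_, fun n X => ?_⟩
    · rw [hc, ← e.sum_comp]
    · refine le_trans (le_of_eq ?_) (hc' n X)
      exact e.sum_comp fun t => |c t| * Net.dataNorm fun k => φ t (X k)
  cases l with
  | fc p q =>
    refine ⟨q.Idx × p.Idx, inferInstance, Fintype.card_prod _ _,
      fun t x => WithLp.toLp 2 fun i => if i = t.1 then x t.2 else 0, fun A A₀ => ?_⟩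
    change Matrix q.Idx p.Idx ℝ at A A₀
    refine ⟨fun t => (A - A₀) t.1 t.2, fun x => ?_, fun n X => ?_⟩
    · ext i
      simp only [Layer.map, PiLp.sub_apply, Matrix.mulVec, dotProduct, PiLp.smul_apply,
        WithLp.ofLp_sum, Finset.sum_apply, smul_eq_mul, Fintype.sum_prod_type, mul_ite, mul_zero]
      rw [Finset.sum_comm]
      simp [← Finset.sum_sub_distrib, sub_mul]
    · simp only [Layer.dist21, matrixNorm21]
      rw [Fintype.sum_prod_type, Finset.sum_mul]
      refine Finset.sum_le_sum fun i _ => ?_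
      refine sum_abs_mul_dataNorm_le (φ := fun j (x : p.Space) =>
        (WithLp.toLp 2 fun i' => if i' = i then x j else 0 : q.Space)) (fun x => ?_) _ X
      simp [EuclideanSpace.real_norm_sq_eq]
  | conv cin cout h w kh kw sh sw hsh hsw =>
    refine ⟨Fin cout × Fin cin × Fin kh × Fin kw, inferInstance, by
        simp [Layer.numParams, mul_assoc],
      fun t x => WithLp.toLp 2 fun o : Fin cout × Fin (h ⌈/⌉ sh) × Fin (w ⌈/⌉ sw) =>
        if o.1 = t.1 then zeroPad x t.2.1
          ((sh : ℤ) * (o.2.1 : ℕ) + (t.2.2.1 : ℕ) - ((kh / 2 : ℕ) : ℤ))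
          ((sw : ℤ) * (o.2.2 : ℕ) + (t.2.2.2 : ℕ) - ((kw / 2 : ℕ) : ℤ)) else 0, fun K K₀ => ?_⟩
    change Tensor cout cin kh kw at K K₀
    refine ⟨fun t => (K - K₀) t.1 t.2.1 t.2.2.1 t.2.2.2, fun x => ?_, fun n X => ?_⟩
    · ext o
      simp only [Layer.map, ResNet.conv, PiLp.sub_apply, PiLp.smul_apply,
        WithLp.ofLp_sum, Finset.sum_apply, smul_eq_mul, Fintype.sum_prod_type, mul_ite, mul_zero]
      rw [Finset.sum_eq_single o.1]
      · simp [← Finset.sum_sub_distrib, sub_mul]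
      · intro i _ hi
        simp [hi.symm]
      · simp
    · simp only [Layer.dist21, tensorNorm21]
      rw [Fintype.sum_prod_type, Finset.sum_mul]
      refine Finset.sum_le_sum fun i _ => ?_
      rw [Fintype.sum_prod_type_right, Fintype.sum_prod_type, Finset.sum_mul]
      refine Finset.sum_le_sum fun a _ => ?_
      rw [Finset.sum_mul]
      refine Finset.sum_le_sum fun b _ => ?_
      -- With output channel and kernel offset fixed, Cauchy-Schwarz over the input channels
      -- produces the inner `ℓ₂` norm of the `(2,1)` norm.
      refine sum_abs_mul_dataNorm_le (φ := fun r (x : (Shape.img cin h w).Space) =>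
        (WithLp.toLp 2 fun o : Fin cout × Fin (h ⌈/⌉ sh) × Fin (w ⌈/⌉ sw) =>
          if o.1 = i then zeroPad x r
            ((sh : ℤ) * (o.2.1 : ℕ) + (a : ℕ) - ((kh / 2 : ℕ) : ℤ))
            ((sw : ℤ) * (o.2.2 : ℕ) + (b : ℕ) - ((kw / 2 : ℕ) : ℤ)) else 0 :
          (Shape.img cout (h ⌈/⌉ sh) (w ⌈/⌉ sw)).Space)) (fun x => ?_) _ X
      refine le_trans (le_of_eq ?_) (sum_zeroPad_sq_le x
        (f := fun m : Fin (h ⌈/⌉ sh) => (sh : ℤ) * (m : ℕ) + (a : ℕ) - ((kh / 2 : ℕ) : ℤ))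
        (g := fun m : Fin (w ⌈/⌉ sw) => (sw : ℤ) * (m : ℕ) + (b : ℕ) - ((kw / 2 : ℕ) : ℤ))
        (fun m m' hm => ?_) (fun m m' hm => ?_))
      · refine Finset.sum_congr rfl fun r _ => ?_
        rw [EuclideanSpace.real_norm_sq_eq]
        change ∑ o : Fin cout × Fin (h ⌈/⌉ sh) × Fin (w ⌈/⌉ sw), _ = _
        rw [Fintype.sum_prod_type, Finset.sum_eq_single i]
        · simp
        · intro i' _ hi'
          simp [hi']
        · simp
      · simpa [hsh.ne', Fin.ext_iff] using hm
      · simpa [hsw.ne', Fin.ext_iff] using hm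

/-! ### Lipschitz constants of classes -/

theorem lipschitzWith_of_lip_le {p q : Shape} {f : p.Space → q.Space} {K : ℝ≥0}
    (h : lip f ≤ K) : LipschitzWith K f := by
  intro x y
  rcases eq_or_ne x y with rfl | hxy
  · simp
  · have h1 : edist (f x) (f y) / edist x y ≤ K :=
      le_trans (le_iSup₂ (f := fun x y => edist (f x) (f y) / edist x y) x y) h
    rwa [ENNReal.div_le_iff (edist_pos.2 hxy).ne' (edist_ne_top x y)] at h1

theorem lip_le_of_lipschitzWith {p q : Shape} {f : p.Space → q.Space} {K : ℝ≥0}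
    (h : LipschitzWith K f) : lip f ≤ K :=
  iSup₂_le fun x y => ENNReal.div_le_of_le_mul (h x y)

/-! ### Covers of classes of maps -/

/-- All maps of the class `F` fix `0` and are `A`-Lipschitz, and on every data set `X` of size `n`
the class has a proper cover of radius `A t ‖X‖` and cardinality at most `exp m`. -/
def IsCoverable (n : ℕ) {p q : Shape} (F : Set (p.Space → q.Space)) (A : ℝ≥0) (t m : ℝ) : Prop :=
  (∀ f ∈ F, f 0 = 0 ∧ LipschitzWith A f) ∧
    ∀ X : Fin n → p.Space, ∃ C : Finset (p.Space → q.Space), (C : Set (p.Space → q.Space)) ⊆ F ∧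
      (C.card : ℝ) ≤ Real.exp m ∧
      ∀ f ∈ F, ∃ g ∈ C, Net.dataNorm (fun k => f (X k) - g (X k)) ≤ A * t * Net.dataNorm X

theorem dataNorm_mono {p q : Shape} {n : ℕ} {X : Fin n → p.Space} {Y : Fin n → q.Space} {K : ℝ}
    (hK : 0 ≤ K) (h : ∀ k, ‖X k‖ ≤ K * ‖Y k‖) : Net.dataNorm X ≤ K * Net.dataNorm Y := by
  refine Real.sqrt_le_iff.2 ⟨mul_nonneg hK (dataNorm_nonneg Y), ?_⟩
  rw [mul_pow, dataNorm_sq, Finset.mul_sum]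
  refine Finset.sum_le_sum fun k _ => ?_
  rw [← mul_pow]
  exact pow_le_pow_left₀ (norm_nonneg _) (h k) 2

theorem dataNorm_add_le {p : Shape} {n : ℕ} (X Y : Fin n → p.Space) :
    Net.dataNorm (fun k => X k + Y k) ≤ Net.dataNorm X + Net.dataNorm Y := by
  simp only [dataNorm_eq_norm]
  exact norm_add_le (WithLp.toLp 2 X : PiLp 2 fun _ : Fin n => p.Space) (WithLp.toLp 2 Y)

theorem norm_sub_le_of_lipschitzWith {p q : Shape} {f : p.Space → q.Space} {K : ℝ≥0}
    (h : LipschitzWith K f) (x y : p.Space) : ‖f x - f y‖ ≤ K * ‖x - y‖ := by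
  simpa [dist_eq_norm] using h.dist_le_mul x y

/-- Split `g ∘ f - g' ∘ f'` at `g ∘ f'`. The second class is covered on the data `f' (X)`, of norm
at most `A ‖X‖`; this needs `f' ∈ F`, which is why covers are proper. -/
theorem IsCoverable.comp {n : ℕ} {p q r : Shape} {F : Set (p.Space → q.Space)}
    {G : Set (q.Space → r.Space)} {A A' : ℝ≥0} {t t' m m' : ℝ} (ht' : 0 ≤ t')
    (hF : IsCoverable n F A t m) (hG : IsCoverable n G A' t' m') :
    IsCoverable n {φ | ∃ f ∈ F, ∃ g ∈ G, φ = g ∘ f} (A * A') (t + t') (m + m') := by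
  classical
  refine ⟨?_, fun X => ?_⟩
  · rintro _ ⟨f, hf, g, hg, rfl⟩
    refine ⟨by simp [(hF.1 f hf).1, (hG.1 g hg).1], ?_⟩
    rw [mul_comm]
    exact (hG.1 g hg).2.comp (hF.1 f hf).2
  · obtain ⟨C, hCF, hC, hCX⟩ := hF.2 X
    choose D hDG hD hDX using fun f : p.Space → q.Space => hG.2 fun k => f (X k)
    refine ⟨C.biUnion fun f => (D f).image fun g => g ∘ f, ?_, ?_, ?_⟩
    · intro φ hφ
      obtain ⟨f, hf, hφ⟩ := Finset.mem_biUnion.1 hφ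
      obtain ⟨g, hg, rfl⟩ := Finset.mem_image.1 hφ
      exact ⟨f, hCF hf, g, hDG f hg, rfl⟩
    · calc ((C.biUnion fun f => (D f).image fun g => g ∘ f).card : ℝ)
          ≤ ∑ f ∈ C, ((D f).card : ℝ) := by
            exact_mod_cast Finset.card_biUnion_le.trans
              (Finset.sum_le_sum fun f _ => Finset.card_image_le)
        _ ≤ ∑ _f ∈ C, Real.exp m' := Finset.sum_le_sum fun f _ => hD f
        _ ≤ Real.exp (m + m') := by
            rw [Finset.sum_const, nsmul_eq_mul, Real.exp_add]
            gcongr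
    · rintro _ ⟨f, hf, g, hg, rfl⟩
      obtain ⟨f', hf', hff'⟩ := hCX f hf
      obtain ⟨g', hg', hgg'⟩ := hDX f' g hg
      refine ⟨g' ∘ f', Finset.mem_biUnion.2 ⟨f', hf', Finset.mem_image_of_mem _ hg'⟩, ?_⟩
      have h1 : Net.dataNorm (fun k => g (f (X k)) - g (f' (X k))) ≤ A' * (A * t * Net.dataNorm X) :=
        (dataNorm_mono A'.2 fun k => norm_sub_le_of_lipschitzWith (hG.1 g hg).2 _ _).trans
          (mul_le_mul_of_nonneg_left hff' A'.2)
      have h2 : Net.dataNorm (fun k => f' (X k)) ≤ A * Net.dataNorm X :=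
        dataNorm_mono A.2 fun k => by
          have := norm_sub_le_of_lipschitzWith (hF.1 f' (hCF hf')).2 (X k) 0
          rwa [(hF.1 f' (hCF hf')).1, sub_zero, sub_zero] at this
      have h3 := hgg'.trans (mul_le_mul_of_nonneg_left h2 (mul_nonneg A'.2 ht'))
      have h4 := dataNorm_add_le (fun k => g (f (X k)) - g (f' (X k)))
        (fun k => g (f' (X k)) - g' (f' (X k)))
      simp only [sub_add_sub_cancel] at h4
      refine h4.trans ((add_le_add h1 h3).trans (le_of_eq ?_))
      push_cast
      ring

theorem isCoverable_singleton (n : ℕ) {p q : Shape} {f : p.Space → q.Space} {A : ℝ≥0}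
    (h0 : f 0 = 0) (hf : LipschitzWith A f) : IsCoverable n {f} A 0 0 := by
  refine ⟨by rintro _ rfl; exact ⟨h0, hf⟩, fun X => ⟨{f}, by simp, by simp, ?_⟩⟩
  rintro _ rfl
  exact ⟨_, Finset.mem_singleton_self _, by simp [Net.dataNorm]⟩

theorem Chain.map_list {Arr : Shape → Shape → Type} {α β : Type} (h : α → β)
    (g : {p q : Shape} → Arr p q → α) {p q : Shape} (c : Chain Arr p q) :
    (c.list g).map h = c.list fun a => h (g a) := by
  induction c with
  | nil => simp [Chain.list]
  | snoc c a ih => simp [Chain.list, ih]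

theorem Chain.isCoverable {n : ℕ} {Arr : Shape → Shape → Type}
    {F : {p q : Shape} → Arr p q → Set (p.Space → q.Space)} {A : {p q : Shape} → Arr p q → ℝ≥0}
    {t m : {p q : Shape} → Arr p q → ℝ} (ht : ∀ {p q : Shape} (a : Arr p q), 0 ≤ t a)
    (h : ∀ {p q : Shape} (a : Arr p q), IsCoverable n (F a) (A a) (t a) (m a))
    {p q : Shape} (c : Chain Arr p q) :
    IsCoverable n (c.comp F) (c.list A).prod (c.list t).sum (c.list m).sum := by
  induction c with
  | nil => simpa [Chain.comp, Chain.list] using isCoverable_singleton n rfl LipschitzWith.id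
  | snoc c a ih =>
    simpa only [Chain.comp, Chain.list, List.prod_append, List.sum_append, List.prod_singleton,
      List.sum_singleton] using ih.comp (ht a) (h a)

/-- Turning an external cover into a proper one doubles the radius. -/
theorem exists_proper_cover {α E : Type*} [SeminormedAddCommGroup E] (F : Set α) (d : α → E)
    (C : Finset E) {r : ℝ} (h : ∀ f ∈ F, ∃ w ∈ C, ‖d f - w‖ ≤ r) :
    ∃ C' : Finset α, (C' : Set α) ⊆ F ∧ C'.card ≤ C.card ∧
      ∀ f ∈ F, ∃ g ∈ C', ‖d f - d g‖ ≤ 2 * r := by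
  classical
  let C₀ := C.filter fun w => ∃ f ∈ F, ‖d f - w‖ ≤ r
  have hC₀ : ∀ w : C₀, ∃ f ∈ F, ‖d f - w‖ ≤ r := fun w => (Finset.mem_filter.1 w.2).2
  choose φ hφF hφ using hC₀
  refine ⟨C₀.attach.image φ, ?_, ?_, fun f hf => ?_⟩
  · intro f hf
    obtain ⟨w, -, rfl⟩ := Finset.mem_image.1 hf
    exact hφF w
  · exact Finset.card_image_le.trans (by
      rw [Finset.card_attach]
      exact Finset.card_le_card (Finset.filter_subset _ _))
  · obtain ⟨w, hw, hfw⟩ := h f hf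
    have hw' : w ∈ C₀ := Finset.mem_filter.2 ⟨hw, f, hf, hfw⟩
    refine ⟨φ ⟨w, hw'⟩, Finset.mem_image_of_mem φ (Finset.mem_attach _ _), ?_⟩
    have h1 := hφ ⟨w, hw'⟩
    have h2 : d f - d (φ ⟨w, hw'⟩) = (d f - w) - (d (φ ⟨w, hw'⟩) - w) := by abel
    rw [h2]
    exact (norm_sub_le _ _).trans (by linarith)

/-- Maurey's cover applies to the difference from the reference layer, with budget `b ‖X‖`. Making
it proper costs the factor 2, and dividing by the Lipschitz constant `ρ s` leaves `b / s`. The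
minimum keeps both cardinality bounds available. -/
theorem Stage.isCoverable (n : ℕ) {p q : Shape} (S : Stage p q) (k : ℕ) {m : ℝ}
    (hm : (min (max 1 (2 * S.layer.numParams) ^ k)
      ((k + 1) ^ (2 * S.layer.numParams)) : ℕ) ≤ Real.exp m) :
    IsCoverable n S.functions (S.ρ * S.s.toNNReal) (2 * (S.b / S.s) / √(max k 1 : ℕ)) m := by
  classical
  have hs : ((S.s.toNNReal : ℝ≥0) : ℝ) = S.s := Real.coe_toNNReal _ S.s_pos.le
  refine ⟨?_, fun X => ?_⟩
  · rintro _ ⟨w, hw, -, rfl⟩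
    exact ⟨by simp [Layer.map_zero, S.σ_zero],
      S.σ_lipschitz.comp (lipschitzWith_of_lip_le hw)⟩
  · obtain ⟨φ, hφ⟩ := S.layer.exists_features
    obtain ⟨C, hC1, hC2, hC⟩ := exists_cover_of_sum_le
      (fun t => (WithLp.toLp 2 fun k => φ t (X k) : PiLp 2 fun _ : Fin n => S.mid.Space))
      (a := S.b * Net.dataNorm X) (mul_nonneg S.b_pos.le (dataNorm_nonneg X)) k
    rw [Fintype.card_fin] at hC1 hC2
    let d : S.layer.Weight → PiLp 2 fun _ : Fin n => S.mid.Space := fun w =>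
      WithLp.toLp 2 fun k => S.layer.map w (X k) - S.layer.map S.ref (X k)
    obtain ⟨D, hD, hDC, hDd⟩ := exists_proper_cover
      {w : S.layer.Weight | lip (S.layer.map w) ≤ ENNReal.ofReal S.s ∧
        S.layer.dist21 w S.ref ≤ S.b} d C (r := S.b * Net.dataNorm X / √(max k 1 : ℕ)) (by
      rintro w ⟨-, hw⟩
      obtain ⟨c, hc, hc'⟩ := hφ w S.ref
      have h1 := (hc' n X).trans (mul_le_mul_of_nonneg_right hw (dataNorm_nonneg X))
      simp only [dataNorm_eq_norm X] at h1 hC ⊢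
      simp only [dataNorm_eq_norm] at h1
      obtain ⟨e, he, hce⟩ := hC c h1
      refine ⟨e, he, ?_⟩
      have : d w = ∑ t, c t •
          (WithLp.toLp 2 fun k => φ t (X k) : PiLp 2 fun _ : Fin n => S.mid.Space) := by
        ext1 k
        simp [d, hc, WithLp.ofLp_sum]
      rwa [this])
    refine ⟨D.image fun w => S.σ ∘ S.layer.map w, ?_, ?_, ?_⟩
    · intro f hf
      obtain ⟨w, hw, rfl⟩ := Finset.mem_image.1 hf
      exact ⟨w, (hD hw).1, (hD hw).2, rfl⟩
    · refine le_trans ?_ hm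
      exact_mod_cast Finset.card_image_le.trans (hDC.trans (le_min hC1 hC2))
    · rintro _ ⟨w, hw, hw', rfl⟩
      obtain ⟨w', hw'', hww'⟩ := hDd w ⟨hw, hw'⟩
      refine ⟨_, Finset.mem_image_of_mem _ hw'', ?_⟩
      have h1 : Net.dataNorm (fun k => S.layer.map w (X k) - S.layer.map w' (X k)) ≤
          2 * (S.b * Net.dataNorm X / √(max k 1 : ℕ)) := by
        rw [dataNorm_eq_norm]
        refine le_trans (le_of_eq ?_) hww'
        congr 1
        ext1 k
        simp [d]
      refine ((dataNorm_mono S.ρ.2 fun k => norm_sub_le_of_lipschitzWith S.σ_lipschitz _ _).trans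
        (mul_le_mul_of_nonneg_left h1 S.ρ.2)).trans (le_of_eq ?_)
      have := S.s_pos.ne'
      push_cast
      rw [hs]
      simp only [NNReal.val_eq_coe]
      field_simp

/-! ### Covers of residual blocks -/

/-- Adding the identity leaves distances between maps unchanged, so the absolute radius of the
branch cover is merely reexpressed relative to `Lip(F_i)`. -/
theorem Block.isCoverable (n : ℕ) {p q : Shape} (B : Block p q)
    {k : {p' q' : Shape} → Stage p' q' → ℕ} {m : {p' q' : Shape} → Stage p' q' → ℝ}
    (hm : ∀ {p' q' : Shape} (S : Stage p' q'), (min (max 1 (2 * S.layer.numParams) ^ k S)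
      ((k S + 1) ^ (2 * S.layer.numParams)) : ℕ) ≤ Real.exp (m S)) :
    IsCoverable n B.functions (B.lip.toNNReal * B.ρ)
      ((B.stages.list fun S => (S.ρ : ℝ) * S.s).prod / B.lip *
        (B.stages.list fun S => 2 * (S.b / S.s) / √(max (k S) 1 : ℕ)).sum)
      (B.stages.list m).sum := by
  have hlip : ((B.lip.toNNReal : ℝ≥0) : ℝ) = B.lip := Real.coe_toNNReal _ ENNReal.toReal_nonneg
  have hc := Chain.isCoverable (n := n) (F := Stage.functions)
    (A := fun {_ _} S => S.ρ * S.s.toNNReal)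
    (t := fun {_ _} S => 2 * (S.b / S.s) / √(max (k S) 1 : ℕ)) (m := m)
    (fun S => by have := S.s_pos; have := S.b_pos; positivity)
    (fun S => S.isCoverable n (k S) (hm S)) B.stages
  set A : ℝ≥0 := (B.stages.list fun S => S.ρ * S.s.toNNReal).prod with hA
  have hA' : (B.stages.list fun S => (S.ρ : ℝ) * S.s).prod = A := by
    rw [hA, ← NNReal.coe_toRealHom, map_list_prod, Chain.map_list]
    congr 2
    funext _ _ S
    simp [Real.coe_toNNReal _ S.s_pos.le]
  set T := (B.stages.list fun S => 2 * (S.b / S.s) / √(max (k S) 1 : ℕ)).sum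
  -- Finiteness ensures that the real number `B.lip` really is the Lipschitz constant, since
  -- `toReal` sends infinity to 0.
  have hfin : lipClass B.residuals ≤ (1 + A : ℝ≥0) := by
    refine iSup₂_le ?_
    rintro _ ⟨h, hh, rfl⟩
    exact lip_le_of_lipschitzWith (LipschitzWith.id.add (hc.1 h hh).2)
  have hΛ : ((B.lip.toNNReal : ℝ≥0) : ℝ≥0∞) = lipClass B.residuals :=
    ENNReal.ofReal_toReal (ne_top_of_le_ne_top ENNReal.coe_ne_top hfin)
  have hres : IsCoverable n B.residuals B.lip.toNNReal (A / B.lip * T) (B.stages.list m).sum := by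
    classical
    have hf : ∀ f ∈ B.residuals, f 0 = 0 ∧ LipschitzWith B.lip.toNNReal f := by
      intro f hf
      refine ⟨?_, lipschitzWith_of_lip_le (hΛ ▸ le_iSup₂ (f := fun f _ => ResNet.lip f) f hf)⟩
      obtain ⟨h, hh, rfl⟩ := hf
      simp [(hc.1 h hh).1]
    refine ⟨hf, fun X => ?_⟩
    obtain ⟨C, hC, hCm, hCX⟩ := hc.2 X
    refine ⟨C.image fun h x => x + h x, ?_, ?_, ?_⟩
    · intro f hf
      obtain ⟨h, hh, rfl⟩ := Finset.mem_image.1 hf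
      exact ⟨h, hC hh, rfl⟩
    · refine le_trans ?_ hCm
      exact_mod_cast Finset.card_image_le
    · rintro _ ⟨h, hh, rfl⟩
      obtain ⟨g, hg, hgh⟩ := hCX h hh
      refine ⟨_, Finset.mem_image_of_mem _ hg, ?_⟩
      rw [hlip]
      -- If the constant is 0, all maps of the block vanish, so the junk quotient is harmless.
      rcases eq_or_ne B.lip 0 with h0 | h0
      · have hz : ∀ f ∈ B.residuals, ∀ x, f x = 0 := fun f hf' x => by
          have := norm_sub_le_of_lipschitzWith (hf f hf').2 x 0
          rw [hlip, h0, zero_mul, (hf f hf').1, sub_zero] at this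
          exact norm_le_zero_iff.1 this
        have h1 := hz _ ⟨h, hh, rfl⟩
        have h2 := hz _ ⟨g, hC hg, rfl⟩
        simp [h1, h2, h0, Net.dataNorm]
      · rw [← mul_assoc, mul_div_cancel₀ _ h0]
        simpa using hgh
  have := hres.comp le_rfl (isCoverable_singleton n B.σ_zero B.σ_lipschitz)
  rw [add_zero, add_zero] at this
  rw [hA']
  convert this using 1
  ext φ
  simp [Block.functions]

/-! ### Sums over the layers of a network -/

/-- A block together with one of its layers. -/
abbrev BlockLayer : Type :=
  Σ (p q : Shape) (_ : Block p q) (p' q' : Shape), Stage p' q'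

theorem le_foldr_max {l : List ℕ} {a : ℕ} (h : a ∈ l) : a ≤ l.foldr max 0 := by
  induction l with
  | nil => simp at h
  | cons b l ih =>
    rcases List.mem_cons.1 h with rfl | h
    · exact le_max_left _ _
    · exact (ih h).trans (le_max_right _ _)

theorem Chain.mul_sum_list {Arr : Shape → Shape → Type} (r : ℝ)
    (g : {p q : Shape} → Arr p q → ℝ) {p q : Shape} (c : Chain Arr p q) :
    r * (c.list g).sum = (c.list fun a => r * g a).sum := by
  rw [← Chain.map_list, List.sum_map_mul_left, List.map_id']

theorem Chain.prod_list_nonneg {Arr : Shape → Shape → Type} (g : {p q : Shape} → Arr p q → ℝ)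
    (hg : ∀ {p q : Shape} (a : Arr p q), 0 ≤ g a) {p q : Shape} (c : Chain Arr p q) :
    0 ≤ (c.list g).prod := by
  induction c with
  | nil => simp [Chain.list]
  | snoc c a ih => simpa [Chain.list] using mul_nonneg ih (hg a)

theorem Chain.sum_list_nonneg {Arr : Shape → Shape → Type} (g : {p q : Shape} → Arr p q → ℝ)
    (hg : ∀ {p q : Shape} (a : Arr p q), 0 ≤ g a) {p q : Shape} (c : Chain Arr p q) :
    0 ≤ (c.list g).sum := by
  induction c with
  | nil => simp [Chain.list]
  | snoc c a ih => simpa [Chain.list] using add_nonneg ih (hg a)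

namespace Net

variable {p q : Shape}

theorem mul_layerSum (N : Net p q) (r : ℝ)
    (a : {p' q' : Shape} → Block p' q' → {p'' q'' : Shape} → Stage p'' q'' → ℝ) :
    r * N.layerSum a = N.layerSum fun {_ _} B {_ _} S => r * a B S := by
  unfold layerSum
  rw [Chain.mul_sum_list]
  simp only [Chain.mul_sum_list]

/-- Sums over the layers are sums over a finite type. -/
theorem exists_layers (N : Net p q) : ∃ (l : ℕ) (T : Fin l → BlockLayer),
    (∀ a : {p' q' : Shape} → Block p' q' → {p'' q'' : Shape} → Stage p'' q'' → ℝ,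
      N.layerSum a = ∑ i, a (T i).2.2.1 (T i).2.2.2.2.2) ∧
    ∀ i, (T i).2.2.2.2.2.layer.numParams ≤ N.maxParams := by
  let L : List (List BlockLayer) :=
    N.list fun B => B.stages.list fun S => (⟨_, _, B, _, _, S⟩ : BlockLayer)
  refine ⟨L.flatten.length, fun i => L.flatten[i], fun a => ?_, fun i => ?_⟩
  · have h := Fin.sum_univ_fun_getElem L.flatten fun x : BlockLayer => a x.2.2.1 x.2.2.2.2.2
    refine Eq.trans ?_ h.symm
    rw [List.map_flatten, List.sum_flatten, List.map_map, Chain.map_list]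
    simp only [Function.comp_apply, Chain.map_list]
    rfl
  · obtain ⟨l, hl, hx⟩ := List.mem_flatten.1 (List.getElem_mem i.2)
    have h1 : N.maxParams = (L.map fun l => (l.map fun x : BlockLayer =>
        x.2.2.2.2.2.layer.numParams).foldr max 0).foldr max 0 := by
      rw [Chain.map_list]
      simp only [Chain.map_list]
      rfl
    rw [h1]
    exact (le_foldr_max (List.mem_map_of_mem (f := fun x : BlockLayer =>
      x.2.2.2.2.2.layer.numParams) hx)).trans
      (le_foldr_max (List.mem_map_of_mem (f := fun l : List BlockLayer => (l.map fun x =>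
        x.2.2.2.2.2.layer.numParams).foldr max 0) hl))

theorem capacity_nonneg (N : Net p q) {γ : ℝ} (hγ : 0 < γ) {n : ℕ} (X : Fin n → p.Space)
    {p' q' : Shape} (B : Block p' q') {p'' q'' : Shape} (S : Stage p'' q'') :
    0 ≤ N.capacity γ X B S := by
  have h1 := Chain.prod_list_nonneg (fun {_ _} (B' : Block _ _) => B'.lip * (B'.ρ : ℝ))
    (fun B' => mul_nonneg ENNReal.toReal_nonneg B'.ρ.2) N
  have h2 := Chain.prod_list_nonneg (fun {_ _} (S' : Stage _ _) => (S'.ρ : ℝ) * S'.s)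
    (fun S' => mul_nonneg S'.ρ.2 S'.s_pos.le) B.stages
  have h3 : 0 ≤ B.lip := ENNReal.toReal_nonneg
  have h4 := S.b_pos
  have h5 := S.s_pos
  have h6 := dataNorm_nonneg X
  unfold capacity
  positivity

/-- The class of a network is coverable, with constants determined by a choice of sparsity levels
`k` for the layers. -/
theorem isCoverable (N : Net p q) (n : ℕ)
    (k : {p' q' : Shape} → Block p' q' → {p'' q'' : Shape} → Stage p'' q'' → ℕ)
    (m : {p' q' : Shape} → Block p' q' → {p'' q'' : Shape} → Stage p'' q'' → ℝ)
    (hm : ∀ {p' q' : Shape} (B : Block p' q') {p'' q'' : Shape} (S : Stage p'' q''),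
      (min (max 1 (2 * S.layer.numParams) ^ k B S)
        ((k B S + 1) ^ (2 * S.layer.numParams)) : ℕ) ≤ Real.exp (m B S)) :
    IsCoverable n N.functions (N.list fun B => B.lip.toNNReal * B.ρ).prod
      (N.list fun B => (B.stages.list fun S => (S.ρ : ℝ) * S.s).prod / B.lip *
        (B.stages.list fun S => 2 * (S.b / S.s) / √(max (k B S) 1 : ℕ)).sum).sum
      (N.layerSum m) :=
  Chain.isCoverable (n := n) (F := Block.functions)
    (A := fun {_ _} B => B.lip.toNNReal * B.ρ)
    (t := fun {_ _} B => (B.stages.list fun S => (S.ρ : ℝ) * S.s).prod / B.lip *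
        (B.stages.list fun S => 2 * (S.b / S.s) / √(max (k B S) 1 : ℕ)).sum)
    (m := fun {_ _} B => (B.stages.list (m B)).sum) (fun B =>
      mul_nonneg (div_nonneg (Chain.prod_list_nonneg _
        (fun S => mul_nonneg S.ρ.2 S.s_pos.le) _) ENNReal.toReal_nonneg)
        (Chain.sum_list_nonneg _ (fun S => by
          have := S.s_pos
          have := S.b_pos
          positivity) _)) (fun B => B.isCoverable n (hm B)) N

theorem continuous_of_mem_functions (N : Net p q) {f : p.Space → q.Space}
    (hf : f ∈ N.functions) : Continuous f :=
  ((N.isCoverable 0 (fun _ _ => 0) (fun _ _ => 0) (by simp)).1 f hf).2.continuous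

/-- Every network class has covers whose radii and cardinalities are controlled by the capacities
and by a choice of sparsity levels `k` for the layers. -/
theorem exists_cover (N : Net p q) {γ : ℝ} (hγ : 0 < γ) {n : ℕ} (hn : 1 ≤ n)
    (k : {p' q' : Shape} → Block p' q' → {p'' q'' : Shape} → Stage p'' q'' → ℕ)
    (m : {p' q' : Shape} → Block p' q' → {p'' q'' : Shape} → Stage p'' q'' → ℝ)
    (hm : ∀ {p' q' : Shape} (B : Block p' q') {p'' q'' : Shape} (S : Stage p'' q''),
      (min (max 1 (2 * S.layer.numParams) ^ k B S)
        ((k B S + 1) ^ (2 * S.layer.numParams)) : ℕ) ≤ Real.exp (m B S))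
    (X : Fin n → p.Space) :
    ∃ C : Finset (p.Space → q.Space), (C.card : ℝ) ≤ Real.exp (N.layerSum m) ∧
      ∀ f ∈ N.functions, ∃ g ∈ C, 2 / γ * dataNorm (fun i => f (X i) - g (X i)) ≤
        √n * N.layerSum fun {_ _} B {_ _} S => N.capacity γ X B S / √(max (k B S) 1 : ℕ) := by
  obtain ⟨C, -, hC, hCX⟩ := (N.isCoverable n k m hm).2 X
  refine ⟨C, hC, fun f hf => ?_⟩
  obtain ⟨g, hg, hfg⟩ := hCX f hf
  refine ⟨g, hg, (mul_le_mul_of_nonneg_left hfg (by positivity)).trans (le_of_eq ?_)⟩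
  have hA : (((N.list fun B => B.lip.toNNReal * B.ρ).prod : ℝ≥0) : ℝ) =
      (N.list fun B => B.lip * (B.ρ : ℝ)).prod := by
    rw [← NNReal.coe_toRealHom, map_list_prod, Chain.map_list]
    congr 2
    funext _ _ B
    simp [Real.coe_toNNReal B.lip ENNReal.toReal_nonneg]
  -- The 4 in the capacity is the 2 of the proper covers times the 2 in the Lipschitz constant `2/γ`
  -- of the margin loss.
  rw [hA, mul_layerSum]
  have h1 : ∀ x : ℝ, 2 / γ * ((N.list fun B => B.lip * (B.ρ : ℝ)).prod * x * dataNorm X) =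
      2 / γ * (N.list fun B => B.lip * (B.ρ : ℝ)).prod * dataNorm X * x := fun x => by ring
  rw [h1, Chain.mul_sum_list]
  unfold layerSum
  have hn' : √(n : ℝ) ≠ 0 := (Real.sqrt_pos.2 (by exact_mod_cast hn)).ne'
  congr 2
  funext _ _ B
  rw [← mul_assoc, Chain.mul_sum_list]
  congr 2
  funext _ _ S
  unfold capacity
  field_simp
  ring

end Net

/-! ### The loss -/

theorem rampLoss_eq {γ : ℝ} (hγ : 0 < γ) (r : ℝ) : rampLoss γ r = max 0 (min 1 (1 + r / γ)) := by
  unfold rampLoss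
  rcases lt_or_ge 0 r with h | h
  · rw [Set.indicator_of_notMem (by simp [h]), Set.indicator_of_mem (by simpa using h),
      min_eq_left (by have := div_pos h hγ; linarith)]
    simp
  · rw [Set.indicator_of_notMem (s := Set.Ioi (0 : ℝ)) (by simpa using h), add_zero,
      min_eq_right (by have := div_nonpos_of_nonpos_of_nonneg h hγ.le; linarith)]
    by_cases h' : -γ ≤ r
    · rw [Set.indicator_of_mem (Set.mem_Icc.2 ⟨h', h⟩), max_eq_right]
      have := (le_div_iff₀ hγ).2 (by linarith : -1 * γ ≤ r)
      linarith
    · rw [Set.indicator_of_notMem (fun hm => h' hm.1), max_eq_left]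
      have := (div_le_iff₀ hγ).2 (by linarith : r ≤ -1 * γ)
      linarith

theorem rampLoss_mem_Icc {γ : ℝ} (hγ : 0 < γ) (r : ℝ) : rampLoss γ r ∈ Set.Icc (0 : ℝ) 1 := by
  rw [rampLoss_eq hγ]
  exact ⟨le_max_left _ _, max_le zero_le_one (min_le_left _ _)⟩

theorem rampLoss_of_nonneg {γ : ℝ} (hγ : 0 < γ) {r : ℝ} (hr : 0 ≤ r) : rampLoss γ r = 1 := by
  rw [rampLoss_eq hγ, min_eq_left (by have := div_nonneg hr hγ.le; linarith)]
  simp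

theorem abs_rampLoss_sub_le {γ : ℝ} (hγ : 0 < γ) (r r' : ℝ) :
    |rampLoss γ r - rampLoss γ r'| ≤ |r - r'| / γ := by
  rw [rampLoss_eq hγ, rampLoss_eq hγ]
  refine (abs_max_sub_max_le_max _ _ _ _).trans ?_
  rw [sub_self, abs_zero, max_eq_right (abs_nonneg _)]
  refine (abs_min_sub_min_le_max _ _ _ _).trans ?_
  rw [sub_self, abs_zero, max_eq_right (abs_nonneg _), add_sub_add_left_eq_sub, ← sub_div, abs_div,
    abs_of_pos hγ]

section Margin

variable {κ : ℕ}

theorem abs_apply_sub_le (v v' : (Shape.vec κ).Space) (i : Fin κ) : |v i - v' i| ≤ ‖v - v'‖ := by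
  simpa using PiLp.norm_apply_le (v - v') i

theorem nonempty_ne (hκ : 2 ≤ κ) (y : Fin κ) : Nonempty {i : Fin κ // i ≠ y} := by
  have : Nontrivial (Fin κ) := Fin.nontrivial_iff_two_le.2 hκ
  obtain ⟨i, hi⟩ := exists_ne y
  exact ⟨⟨i, hi⟩⟩

/-- The true score and the competing maximum each move by at most the distance; `κ ≥ 2` makes the
maximum nonempty. -/
theorem abs_margin_sub_le (hκ : 2 ≤ κ) (v v' : (Shape.vec κ).Space) (y : Fin κ) :
    |margin v y - margin v' y| ≤ 2 * ‖v - v'‖ := by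
  have := nonempty_ne hκ y
  have h1 : ⨆ i : {i : Fin κ // i ≠ y}, v i.1 ≤ (⨆ i : {i : Fin κ // i ≠ y}, v' i.1) + ‖v - v'‖ :=
    ciSup_le_ciSup_add fun i => by linarith [(abs_le.1 (abs_apply_sub_le v v' i.1)).2]
  have h2 : ⨆ i : {i : Fin κ // i ≠ y}, v' i.1 ≤ (⨆ i : {i : Fin κ // i ≠ y}, v i.1) + ‖v - v'‖ :=
    ciSup_le_ciSup_add fun i => by linarith [(abs_le.1 (abs_apply_sub_le v v' i.1)).1]
  have h3 := abs_le.1 (abs_apply_sub_le v v' y)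
  unfold margin
  exact abs_le.2 ⟨by linarith [h3.1], by linarith [h3.2]⟩

/-- The ramp loss of the margin of the score vector `v` with label `y`. -/
def marginLoss (γ : ℝ) (v : (Shape.vec κ).Space) (y : Fin κ) : ℝ := rampLoss γ (-margin v y)

theorem marginLoss_mem_Icc {γ : ℝ} (hγ : 0 < γ) (v : (Shape.vec κ).Space) (y : Fin κ) :
    marginLoss γ v y ∈ Set.Icc (0 : ℝ) 1 :=
  rampLoss_mem_Icc hγ _

theorem abs_marginLoss_le {γ : ℝ} (hγ : 0 < γ) (v : (Shape.vec κ).Space) (y : Fin κ) :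
    |marginLoss γ v y| ≤ 1 :=
  abs_le.2 ⟨by linarith [(marginLoss_mem_Icc hγ v y).1], (marginLoss_mem_Icc hγ v y).2⟩

theorem abs_marginLoss_sub_le (hκ : 2 ≤ κ) {γ : ℝ} (hγ : 0 < γ) (v v' : (Shape.vec κ).Space)
    (y : Fin κ) : |marginLoss γ v y - marginLoss γ v' y| ≤ 2 / γ * ‖v - v'‖ := by
  refine (abs_rampLoss_sub_le hγ _ _).trans ?_
  rw [neg_sub_neg, abs_sub_comm, div_mul_eq_mul_div]
  gcongr
  exact abs_margin_sub_le hκ v v' y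

theorem continuous_marginLoss (hκ : 2 ≤ κ) {γ : ℝ} (hγ : 0 < γ) (y : Fin κ) :
    Continuous fun v : (Shape.vec κ).Space => marginLoss γ v y := by
  refine (LipschitzWith.of_dist_le_mul (K := (2 / γ).toNNReal) fun v v' => ?_).continuous
  rw [Real.dist_eq, dist_eq_norm, Real.coe_toNNReal _ (by positivity)]
  exact abs_marginLoss_sub_le hκ hγ v v' y

theorem measurable_marginLoss (hκ : 2 ≤ κ) {γ : ℝ} (hγ : 0 < γ) {p : Shape}
    {f : p.Space → (Shape.vec κ).Space} (hf : Continuous f) :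
    Measurable fun z : p.Space × Fin κ => marginLoss γ (f z.1) z.2 :=
  measurable_from_prod_countable_left fun y =>
    ((continuous_marginLoss hκ hγ y).comp hf).measurable

/-- A positive margin makes `y` the unique maximizer; ties therefore have margin at most 0 and full
loss. -/
theorem marginLoss_eq_one_of_argmax_ne (hκ : 2 ≤ κ) {γ : ℝ} (hγ : 0 < γ)
    {v : (Shape.vec κ).Space} {y : Fin κ} (h : argmax v ≠ {y}) : marginLoss γ v y = 1 := by
  refine rampLoss_of_nonneg hγ ?_
  have := nonempty_ne hκ y
  by_contra! hm
  refine h (Set.eq_singleton_iff_unique_mem.2 ?_)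
  have hlt : ∀ i, i ≠ y → v i < v y := fun i hi => by
    have h1 := le_ciSup (f := fun i : {i : Fin κ // i ≠ y} => v i.1)
      (Set.finite_range _).bddAbove ⟨i, hi⟩
    simp only [margin] at h1 hm
    linarith
  refine ⟨fun j => ?_, fun i hi => ?_⟩
  · rcases eq_or_ne j y with rfl | hj
    · exact le_rfl
    · exact (hlt j hj).le
  · by_contra hne
    exact absurd (hi y) (not_le.2 (hlt i hne))

theorem misclassification_le_integral (hκ : 2 ≤ κ) {γ : ℝ} (hγ : 0 < γ) {p : Shape}
    (D : MeasureTheory.Measure (p.Space × Fin κ)) [MeasureTheory.IsProbabilityMeasure D]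
    {f : p.Space → (Shape.vec κ).Space} (hf : Continuous f) :
    misclassification D f ≤ ∫ z, marginLoss γ (f z.1) z.2 ∂D := by
  have hi : MeasureTheory.Integrable (fun z => marginLoss γ (f z.1) z.2) D :=
    integrable_of_abs_le (measurable_marginLoss hκ hγ hf) fun z =>
      abs_marginLoss_le hγ _ _
  have h1 := MeasureTheory.mul_meas_ge_le_integral_of_nonneg (μ := D)
    (f := fun z => marginLoss γ (f z.1) z.2)
    (Filter.Eventually.of_forall fun z => (marginLoss_mem_Icc hγ (f z.1) z.2).1) hi 1
  rw [one_mul] at h1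
  refine le_trans (MeasureTheory.measureReal_mono fun z hz => ?_) h1
  exact (marginLoss_eq_one_of_argmax_ne hκ hγ hz).ge

end Margin

/-! ### Rademacher complexity of residual networks -/

/-- Writing `w = ⌈b^(2/3)⌉`, one has `b² ≤ w³`. When `c` is the sum of all `w`, the layers receive
shares `w / c` of the radius `2^(-j)`. -/
theorem div_sqrt_ceil_rpow_le {b : ℝ} (hb : 0 ≤ b) {c : ℕ} (hc : 0 < c) (j : ℕ) :
    b / √(max (⌈b ^ (2 / 3 : ℝ)⌉₊ * c ^ 2 * 4 ^ j) 1 : ℕ) ≤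
      (⌈b ^ (2 / 3 : ℝ)⌉₊ : ℝ) / c * (1 / 2) ^ j := by
  rcases hb.eq_or_lt with rfl | h
  · rw [zero_div]
    positivity
  have hw1 : 0 < ⌈b ^ (2 / 3 : ℝ)⌉₊ := Nat.ceil_pos.2 (Real.rpow_pos_of_pos h _)
  have hbw : b ^ (2 / 3 : ℝ) ≤ ⌈b ^ (2 / 3 : ℝ)⌉₊ := Nat.le_ceil _
  have hb3 : (b ^ (2 / 3 : ℝ)) ^ 3 = b ^ 2 := by
    rw [← Real.rpow_natCast, ← Real.rpow_mul hb,
      show (2 / 3 : ℝ) * ((3 : ℕ) : ℝ) = (2 : ℕ) by norm_num, Real.rpow_natCast]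
  have hb2 : b ^ 2 ≤ (⌈b ^ (2 / 3 : ℝ)⌉₊ : ℝ) ^ 3 :=
    hb3 ▸ pow_le_pow_left₀ (Real.rpow_nonneg hb _) hbw 3
  generalize ⌈b ^ (2 / 3 : ℝ)⌉₊ = w at hw1 hb2
  have hK : 0 < w * c ^ 2 * 4 ^ j := by positivity
  have hc' : (0 : ℝ) < c := by exact_mod_cast hc
  rw [max_eq_left hK, div_le_iff₀ (Real.sqrt_pos.2 (by exact_mod_cast hK))]
  refine (Real.le_sqrt_of_sq_le hb2).trans (le_of_eq ?_)
  have e : ((w * c ^ 2 * 4 ^ j : ℕ) : ℝ) = w * (c * 2 ^ j) ^ 2 := by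
    push_cast
    rw [mul_pow, ← pow_mul, mul_comm j 2, pow_mul]
    norm_num
    ring
  have e3 : (w : ℝ) ^ 3 = w * w ^ 2 := by ring
  rw [e, e3, Real.sqrt_mul (by positivity), Real.sqrt_mul (by positivity),
    Real.sqrt_sq (by positivity), Real.sqrt_sq (by positivity), one_div, inv_pow]
  field_simp

/-- Here the radius `2^(-j)` is split equally among the `l` layers. -/
theorem div_sqrt_ceil_sq_le {b : ℝ} (hb : 0 ≤ b) {l : ℕ} (hl : 0 < l) (j : ℕ) :
    b / √(max (4 ^ j * ⌈(l : ℝ) ^ 2 * b ^ 2⌉₊) 1 : ℕ) ≤ (1 / 2) ^ j / l := by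
  have hl0 : (0 : ℝ) < l := by exact_mod_cast hl
  rcases hb.eq_or_lt with rfl | h
  · rw [zero_div]
    positivity
  have hK : 0 < 4 ^ j * ⌈(l : ℝ) ^ 2 * b ^ 2⌉₊ :=
    mul_pos (by positivity) (Nat.ceil_pos.2 (by positivity))
  rw [max_eq_left hK, div_le_iff₀ (Real.sqrt_pos.2 (by exact_mod_cast hK)),
    div_mul_eq_mul_div, le_div_iff₀ hl0, one_div, inv_pow, inv_mul_eq_div,
    le_div_iff₀ (by positivity)]
  refine Real.le_sqrt_of_sq_le ?_
  have h4 : ((2 : ℝ) ^ j) ^ 2 = 4 ^ j := by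
    rw [← pow_mul, mul_comm, pow_mul]; norm_num
  rw [mul_pow, h4, mul_comm]
  push_cast
  gcongr
  rw [mul_comm b, mul_pow]
  exact Nat.le_ceil _

section LossVectors

variable {p : Shape} {κ n : ℕ}

/-- The vector of the losses of `f` on a sample. -/
def lossVec (γ : ℝ) (S : Fin n → p.Space × Fin κ) (f : p.Space → (Shape.vec κ).Space) :
    EuclideanSpace ℝ (Fin n) :=
  WithLp.toLp 2 fun k => marginLoss γ (f (S k).1) (S k).2

theorem norm_lossVec_le {γ : ℝ} (hγ : 0 < γ) (S : Fin n → p.Space × Fin κ)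
    (f : p.Space → (Shape.vec κ).Space) : ‖lossVec γ S f‖ ≤ √n := by
  rw [EuclideanSpace.norm_eq]
  refine Real.sqrt_le_sqrt ?_
  calc ∑ k, ‖lossVec γ S f k‖ ^ 2 ≤ ∑ _k : Fin n, (1 : ℝ) := Finset.sum_le_sum fun k _ =>
        pow_le_one₀ (norm_nonneg _) (abs_marginLoss_le hγ _ _)
    _ = n := by simp

theorem norm_lossVec_sub_le (hκ : 2 ≤ κ) {γ : ℝ} (hγ : 0 < γ) (S : Fin n → p.Space × Fin κ)
    (f g : p.Space → (Shape.vec κ).Space) :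
    ‖lossVec γ S f - lossVec γ S g‖ ≤ 2 / γ * Net.dataNorm fun k => f (S k).1 - g (S k).1 := by
  rw [EuclideanSpace.norm_eq]
  refine Real.sqrt_le_iff.2 ⟨mul_nonneg (by positivity) (dataNorm_nonneg _), ?_⟩
  rw [mul_pow, dataNorm_sq, Finset.mul_sum]
  refine Finset.sum_le_sum fun k _ => ?_
  rw [← mul_pow]
  exact pow_le_pow_left₀ (norm_nonneg _) (abs_marginLoss_sub_le hκ hγ _ _ _) 2

theorem exists_cover_lossVec (hκ : 2 ≤ κ) (N : Net p (Shape.vec κ)) {γ : ℝ} (hγ : 0 < γ)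
    (hn : 1 ≤ n) (S : Fin n → p.Space × Fin κ)
    (k : {p' q' : Shape} → Block p' q' → {p'' q'' : Shape} → Stage p'' q'' → ℕ)
    (m : {p' q' : Shape} → Block p' q' → {p'' q'' : Shape} → Stage p'' q'' → ℝ)
    (hm : ∀ {p' q' : Shape} (B : Block p' q') {p'' q'' : Shape} (S : Stage p'' q''),
      (min (max 1 (2 * S.layer.numParams) ^ k B S)
        ((k B S + 1) ^ (2 * S.layer.numParams)) : ℕ) ≤ Real.exp (m B S)) {M r : ℝ}
    (hM : N.layerSum m ≤ M)
    (hr : (N.layerSum fun {_ _} B {_ _} L =>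
      N.capacity γ (fun i => (S i).1) B L / √(max (k B L) 1 : ℕ)) ≤ r) :
    ∃ T : Finset (EuclideanSpace ℝ (Fin n)), (T.card : ℝ) ≤ Real.exp M ∧
      ∀ f ∈ N.functions, ∃ w ∈ T, ‖lossVec γ S f - w‖ ≤ √n * r := by
  classical
  obtain ⟨C, hC, hCX⟩ := N.exists_cover hγ hn k m hm fun i => (S i).1
  refine ⟨C.image (lossVec γ S), ?_, fun f hf => ?_⟩
  · refine le_trans ?_ (hC.trans (Real.exp_le_exp.2 hM))
    exact_mod_cast Finset.card_image_le
  · obtain ⟨g, hg, hfg⟩ := hCX f hf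
    exact ⟨_, Finset.mem_image_of_mem _ hg, (norm_lossVec_sub_le hκ hγ S f g).trans
      (hfg.trans (mul_le_mul_of_nonneg_left hr (Real.sqrt_nonneg _)))⟩

variable {ι : Type*} [Finite ι] [Nonempty ι]

/-- The complexity bound in terms of the capacities and the largest layer. -/
theorem rademacher_lossVec_le_norm (hκ : 2 ≤ κ) (N : Net p (Shape.vec κ)) {γ : ℝ} (hγ : 0 < γ)
    (hn : 1 ≤ n) (S : Fin n → p.Space × Fin κ) {f : ι → p.Space → (Shape.vec κ).Space}
    (hf : ∀ i, f i ∈ N.functions) :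
    rademacher (fun i k => lossVec γ S (f i) k) ≤ 4 + 12 * √n * (√(Real.log (2 * N.maxParams)) *
      (N.layerSum fun {_ _} B {_ _} L =>
        (⌈N.capacity γ (fun i => (S i).1) B L ^ (2 / 3 : ℝ)⌉₊ : ℝ)) ^ (3 / 2 : ℝ)) *
      ((harmonic (n - 1) : ℚ) : ℝ) := by
  set X : Fin n → p.Space := fun i => (S i).1 with hX
  obtain ⟨l, T, hT, hTW⟩ := N.exists_layers
  set c : ℕ := ∑ i, ⌈N.capacity γ X (T i).2.2.1 (T i).2.2.2.2.2 ^ (2 / 3 : ℝ)⌉₊ with hc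
  have hlc : (N.layerSum fun {_ _} B {_ _} L => (⌈N.capacity γ X B L ^ (2 / 3 : ℝ)⌉₊ : ℝ)) = c := by
    rw [hT, hc, Nat.cast_sum]
  -- For `W = 0` both logarithms are 0, as `Real.log 0 = 0`.
  have hlog : Real.log (2 * N.maxParams) = Real.log ((max 1 (2 * N.maxParams) : ℕ) : ℝ) := by
    rcases Nat.eq_zero_or_pos N.maxParams with h | h
    · simp [h]
    · rw [max_eq_right (by omega)]
      push_cast
      rfl
  have hlog0 : 0 ≤ Real.log (2 * N.maxParams) := by
    rw [hlog]
    exact Real.log_natCast_nonneg _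
  rw [hlc]
  refine rademacher_le_of_quadratic_entropy hn (fun i => lossVec γ S (f i))
    (fun i => norm_lossVec_le hγ S _) (by positivity) fun j => ?_
  refine (exists_cover_lossVec hκ N hγ hn S
    (fun {_ _} B {_ _} L => ⌈N.capacity γ X B L ^ (2 / 3 : ℝ)⌉₊ * (max c 1) ^ 2 * 4 ^ j)
    (fun {_ _} B {_ _} L => ((⌈N.capacity γ X B L ^ (2 / 3 : ℝ)⌉₊ * (max c 1) ^ 2 * 4 ^ j : ℕ) : ℝ) *
      Real.log ((max 1 (2 * L.layer.numParams) : ℕ) : ℝ)) (fun {_ _} B {_ _} L => by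
        rw [← Real.log_pow, Real.exp_log (by positivity)]
        exact_mod_cast min_le_left _ _)
    (M := (√(Real.log (2 * N.maxParams)) * (c : ℝ) ^ (3 / 2 : ℝ)) ^ 2 * 4 ^ j)
    (r := (1 / 2) ^ j) ?_ ?_).imp fun U hU => ⟨hU.1, fun i => hU.2 _ (hf i)⟩
  -- The sparsity levels sum to `c³ 4^j`, whence the exponent `3/2` of `c` in the entropy constant.
  · rw [hT, mul_pow, Real.sq_sqrt hlog0, ← Real.rpow_natCast, ← Real.rpow_mul (by positivity)]
    calc _ ≤ ∑ i, ((⌈N.capacity γ X (T i).2.2.1 (T i).2.2.2.2.2 ^ (2 / 3 : ℝ)⌉₊ *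
          (max c 1) ^ 2 * 4 ^ j : ℕ) : ℝ) * Real.log (2 * N.maxParams) := by
          refine Finset.sum_le_sum fun i _ => mul_le_mul_of_nonneg_left ?_ (by positivity)
          rw [hlog]
          refine Real.log_le_log (by positivity) ?_
          have := hTW i
          exact_mod_cast max_le_max le_rfl (by omega)
      _ = ((c * (max c 1) ^ 2 * 4 ^ j : ℕ) : ℝ) * Real.log (2 * N.maxParams) := by
          rw [← Finset.sum_mul, ← Nat.cast_sum, ← Finset.sum_mul, ← Finset.sum_mul]
      _ = _ := by
          have h3 : c * (max c 1) ^ 2 = c ^ 3 := by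
            rcases Nat.eq_zero_or_pos c with h | h
            · simp [h]
            · rw [max_eq_left h]; ring
          rw [h3]
          norm_num
          ring
  · have hc1 : (0 : ℝ) < max c 1 := by positivity
    rw [hT]
    calc _ ≤ ∑ i, (⌈N.capacity γ X (T i).2.2.1 (T i).2.2.2.2.2 ^ (2 / 3 : ℝ)⌉₊ : ℝ) / (max c 1 : ℕ) *
          (1 / 2) ^ j := by
          refine Finset.sum_le_sum fun i _ => ?_
          exact div_sqrt_ceil_rpow_le (N.capacity_nonneg hγ X _ _) (by positivity) j
      _ = (c : ℝ) / (max c 1 : ℕ) * (1 / 2) ^ j := by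
          rw [← Finset.sum_mul, ← Finset.sum_div, ← Nat.cast_sum]
      _ ≤ (1 / 2) ^ j := by
          refine mul_le_of_le_one_left (by positivity) (div_le_one_of_le₀ ?_ (by positivity))
          exact_mod_cast le_max_left _ _

/-- The complexity bound in terms of the capacities and the number of parameters. -/
theorem rademacher_lossVec_le_param (hκ : 2 ≤ κ) (N : Net p (Shape.vec κ)) {γ : ℝ} (hγ : 0 < γ)
    (hn : 1 ≤ n) (S : Fin n → p.Space × Fin κ) {f : ι → p.Space → (Shape.vec κ).Space}
    (hf : ∀ i, f i ∈ N.functions) :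
    rademacher (fun i k => lossVec γ S (f i) k) ≤ 12 * √n *
      √(2 * N.layerSum fun {_ _} B {_ _} L => (L.layer.numParams : ℝ) *
        (Real.log (1 + ⌈N.numLayers ^ 2 * N.capacity γ (fun i => (S i).1) B L ^ 2⌉₊) +
          psi ⌈N.numLayers ^ 2 * N.capacity γ (fun i => (S i).1) B L ^ 2⌉₊)) := by
  set X : Fin n → p.Space := fun i => (S i).1 with hX
  obtain ⟨l, T, hT, -⟩ := N.exists_layers
  have hl : N.numLayers = l := by
    rw [Net.numLayers, hT]
    simp
  set a : Fin l → ℕ := fun i =>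
    ⌈N.numLayers ^ 2 * N.capacity γ X (T i).2.2.1 (T i).2.2.2.2.2 ^ 2⌉₊ with ha
  set W : Fin l → ℝ := fun i => ((T i).2.2.2.2.2.layer.numParams : ℝ) with hW
  have hW0 : ∀ i, 0 ≤ W i := fun i => Nat.cast_nonneg _
  rw [hT]
  refine rademacher_le_of_summable_entropy hn (fun i => lossVec γ S (f i))
    (fun i => norm_lossVec_le hγ S _) (m := fun j => ∑ i, 2 * W i * Real.log (1 + 4 ^ j * a i))
    (fun j j' hj => Finset.sum_le_sum fun i _ => ?_)
    (Finset.sum_nonneg fun i _ => mul_nonneg (by have := hW0 i; positivity)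
      (Real.log_nonneg (by simp))) (fun j => ?_) fun J => ?_
  · have := hW0 i
    gcongr
    norm_num
  · refine (exists_cover_lossVec hκ N hγ hn S
      (fun {_ _} B {_ _} L => 4 ^ j * ⌈N.numLayers ^ 2 * N.capacity γ X B L ^ 2⌉₊)
      (fun {_ _} B {_ _} L => 2 * (L.layer.numParams : ℝ) *
        Real.log (1 + 4 ^ j * ⌈N.numLayers ^ 2 * N.capacity γ X B L ^ 2⌉₊)) (fun {_ _} B {_ _} L => by
          rw [← Nat.cast_ofNat (R := ℝ) (n := 2), ← Nat.cast_mul, ← Real.log_pow,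
            Real.exp_log (by positivity), add_comm (1 : ℝ)]
          exact_mod_cast min_le_right _ _)
      (M := ∑ i, 2 * W i * Real.log (1 + 4 ^ j * a i)) (r := (1 / 2) ^ j) (hT _).le ?_).imp
        fun U hU => ⟨hU.1, fun i => hU.2 _ (hf i)⟩
    · rw [hT]
      calc _ ≤ ∑ _i : Fin l, (1 / 2 : ℝ) ^ j / l := by
            refine Finset.sum_le_sum fun i _ => ?_
            rw [hl]
            exact div_sqrt_ceil_sq_le (N.capacity_nonneg hγ X _ _) (Fin.pos i) j
        _ ≤ (1 / 2) ^ j := by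
            rw [Finset.sum_const, Finset.card_univ, Fintype.card_fin, nsmul_eq_mul]
            by_cases h : (l : ℝ) = 0
            · rw [h, zero_mul]
              positivity
            · exact (mul_div_cancel₀ _ h).le
  · simp only [Finset.mul_sum]
    rw [Finset.sum_comm]
    refine Finset.sum_le_sum fun i _ => ?_
    calc _ = 2 * W i * ∑ j ∈ Finset.range J,
          (1 / 2 : ℝ) ^ (j + 1) * Real.log (1 + 4 ^ (j + 1) * a i) := by
          rw [Finset.mul_sum]
          exact Finset.sum_congr rfl fun j _ => by ring
      _ ≤ 2 * W i * (4 * (Real.log (1 + a i) + psi (a i))) :=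
          mul_le_mul_of_nonneg_left (sum_log_one_add_le (a i) J) (by have := hW0 i; positivity)
      _ = _ := by ring

end LossVectors

/-! ### Reduction to a countable class -/

/-- The continuous maps between Euclidean spaces form a second countable space in the compact-open
topology, so every subclass is separable, and evaluations are continuous. -/
theorem exists_pointwise_dense_seq {p q : Shape} {F : Set (p.Space → q.Space)}
    (hF : ∀ f ∈ F, Continuous f) (hne : F.Nonempty) :
    ∃ g : ℕ → p.Space → q.Space, (∀ i, g i ∈ F) ∧
      ∀ f ∈ F, ∃ φ : ℕ → ℕ, ∀ x, Filter.Tendsto (fun j => g (φ j) x) Filter.atTop (nhds (f x)) := by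
  let F' : Set C(p.Space, q.Space) := {f | ⇑f ∈ F}
  obtain ⟨f₀, hf₀⟩ := hne
  have : Nonempty F' := ⟨⟨⟨f₀, hF f₀ hf₀⟩, hf₀⟩⟩
  refine ⟨fun i => (TopologicalSpace.denseSeq F' i : C(p.Space, q.Space)),
    fun i => (TopologicalSpace.denseSeq F' i).2, fun f hf => ?_⟩
  obtain ⟨u, hu, hlim⟩ := mem_closure_iff_seq_limit.1
    (TopologicalSpace.denseRange_denseSeq F' ⟨⟨f, hF f hf⟩, hf⟩)
  choose φ hφ using hu
  refine ⟨φ, fun x => ?_⟩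
  simp only [hφ]
  exact (((continuous_eval_const x).comp continuous_subtype_val).tendsto _).comp hlim

/-! ### The generalization bounds -/

/-- A uniform bound for a class of continuous maps all of whose finite subfamilies have loss vectors
of Rademacher complexity at most `B`. -/
theorem measure_exists_misclassification_gt_le {p : Shape} {κ : ℕ} (hκ : 2 ≤ κ) {γ : ℝ}
    (hγ : 0 < γ) (D : Measure (p.Space × Fin κ)) [IsProbabilityMeasure D] {n : ℕ} (hn : 1 ≤ n)
    {F : Set (p.Space → (Shape.vec κ).Space)} (hF : ∀ f ∈ F, Continuous f) {t : ℝ} (ht : 0 ≤ t)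
    {B : (Fin n → p.Space × Fin κ) → ℝ}
    (hB : ∀ (S : Fin n → p.Space × Fin κ) (m : ℕ) (f : Fin (m + 1) → p.Space → (Shape.vec κ).Space),
      (∀ i, f i ∈ F) → rademacher (fun i k => lossVec γ S (f i) k) ≤ B S) :
    (Measure.pi fun _ : Fin n => D) {S | ∃ f ∈ F, empiricalRisk γ S f + 2 * B S / n +
      3 * √(t / (2 * n)) < misclassification D f} ≤ ENNReal.ofReal (Real.exp (-t)) := by
  rcases F.eq_empty_or_nonempty with rfl | hne
  · simp
  obtain ⟨g, hgF, hg⟩ := exists_pointwise_dense_seq hF hne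
  have hgm : ∀ i, Measurable fun z : p.Space × Fin κ => marginLoss γ (g i z.1) z.2 := fun i =>
    measurable_marginLoss hκ hγ (hF _ (hgF i))
  refine (measure_mono fun S hS => ?_).trans (measure_exists_deviation_gt_le D hgm
    (fun i z => marginLoss_mem_Icc hγ _ _) hn ht (B := B)
    fun S m => hB S m (fun i => g i) fun i => hgF i)
  obtain ⟨f, hf, hlt⟩ := hS
  simp only [Set.mem_ofPred_eq]
  by_contra! hle
  obtain ⟨φ, hφ⟩ := hg f hf
  have hlim : ∀ z : p.Space × Fin κ, Filter.Tendsto (fun j => marginLoss γ (g (φ j) z.1) z.2)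
      Filter.atTop (nhds (marginLoss γ (f z.1) z.2)) := fun z =>
    ((continuous_marginLoss hκ hγ z.2).tendsto _).comp (hφ z.1)
  have hint : Filter.Tendsto (fun j => ∫ z, marginLoss γ (g (φ j) z.1) z.2 ∂D)
      Filter.atTop (nhds (∫ z, marginLoss γ (f z.1) z.2 ∂D)) :=
    tendsto_integral_of_dominated_convergence (fun _ => 1)
      (fun j => (hgm _).aestronglyMeasurable) (integrable_const _)
      (fun j => Filter.Eventually.of_forall fun z => abs_marginLoss_le hγ _ _)
      (Filter.Eventually.of_forall hlim)
  -- The assumed inequalities for the dense sequence pass to the limit `f`, the expectations by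
  -- dominated convergence.
  have hsum := le_of_tendsto'
    (tendsto_finsetSum Finset.univ fun k _ => hint.sub (hlim (S k))) fun j => hle (φ j)
  have hn' : (0 : ℝ) < n := by exact_mod_cast hn
  have hsq : √(n * t / 2) = n * √(t / (2 * n)) := by
    rw [show (n : ℝ) * t / 2 = n ^ 2 * (t / (2 * n)) by field_simp, Real.sqrt_mul (by positivity),
      Real.sqrt_sq hn'.le]
  have hemp : ∑ k, marginLoss γ (f (S k).1) (S k).2 = n * empiricalRisk γ S f := by
    rw [empiricalRisk, ← mul_assoc, mul_one_div_cancel hn'.ne', one_mul]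
    rfl
  rw [Finset.sum_sub_distrib, Finset.sum_const, Finset.card_univ, Fintype.card_fin, nsmul_eq_mul,
    hemp, hsq] at hsum
  have hmis := misclassification_le_integral hκ hγ D (hF f hf)
  have h1 := mul_lt_mul_of_pos_left (hlt.trans_le hmis) hn'
  have h2 : (n : ℝ) * (2 * B S / n) = 2 * B S := by field_simp
  rw [mul_add, mul_add, h2] at h1
  linarith

end ResNet

end

theorem mainTheorem4 {p : ResNet.Shape} {κ : ℕ} (hκ : 2 ≤ κ)
    (N : ResNet.Net p (ResNet.Shape.vec κ))
    (γ : ℝ) (hγ : 0 < γ) (δ : ℝ) (hδ : 0 < δ) (hδ1 : δ < 1)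
    (D : MeasureTheory.Measure (p.Space × Fin κ)) [MeasureTheory.IsProbabilityMeasure D]
    (n : ℕ) (hn : 1 ≤ n) :
    -- the samples `S ∼ D^n` for which some network violates one of the bounds have probability
    -- at most `δ`
    (MeasureTheory.Measure.pi fun _ : Fin n => D)
      {S : Fin n → p.Space × Fin κ |
        ∀ f ∈ N.functions,
          ResNet.misclassification D f
              ≤ ResNet.empiricalRisk γ S f + N.normBound γ δ (fun k => (S k).1) ∧
          ResNet.misclassification D f
              ≤ ResNet.empiricalRisk γ S f + N.paramBound γ δ (fun k => (S k).1)}ᶜ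
      ≤ ENNReal.ofReal δ := by
  open ResNet in
  have hn' : (0 : ℝ) < n := by exact_mod_cast hn
  have ht : 0 ≤ Real.log (2 / δ) := Real.log_nonneg (by rw [le_div_iff₀ hδ]; linarith)
  set B₁ : (Fin n → p.Space × Fin κ) → ℝ := fun S =>
    4 + 12 * √n * (√(Real.log (2 * N.maxParams)) * (N.layerSum fun {_ _} B {_ _} L =>
      (⌈N.capacity γ (fun i => (S i).1) B L ^ (2 / 3 : ℝ)⌉₊ : ℝ)) ^ (3 / 2 : ℝ)) *
      ((harmonic (n - 1) : ℚ) : ℝ) with hB₁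
  set B₂ : (Fin n → p.Space × Fin κ) → ℝ := fun S =>
    12 * √n * √(2 * N.layerSum fun {_ _} B {_ _} L => (L.layer.numParams : ℝ) *
      (Real.log (1 + ⌈N.numLayers ^ 2 * N.capacity γ (fun i => (S i).1) B L ^ 2⌉₊) +
        psi ⌈N.numLayers ^ 2 * N.capacity γ (fun i => (S i).1) B L ^ 2⌉₊)) with hB₂
  have hsn : √(n : ℝ) / n = 1 / √n := by
    rw [Real.sqrt_div_self]
    simp
  have h1 : ∀ S, N.normBound γ δ (fun k => (S k).1) =
      2 * B₁ S / n + 3 * √(Real.log (2 / δ) / (2 * n)) := fun S => by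
    have e : ∀ x y z : ℝ, 2 * (4 + 12 * √n * (x * y) * z) / n =
        8 / n + 24 * x * y * z * (√n / n) := fun x y z => by ring
    rw [hB₁, Net.normBound, e, hsn]
    ring
  have h2 : ∀ S, N.paramBound γ δ (fun k => (S k).1) =
      2 * B₂ S / n + 3 * √(Real.log (2 / δ) / (2 * n)) := fun S => by
    have e : ∀ x : ℝ, 2 * (12 * √n * x) / n = 24 * (√n / n) * x := fun x => by ring
    rw [hB₂, Net.paramBound, e, hsn]
    ring
  -- Both complexity bounds hold for every sample, so their minimum may serve as `B`: one event
  -- covers both claims without a union bound. Its probability is at most `δ/2`.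
  refine (MeasureTheory.measure_mono fun S hS => ?_).trans
    ((measure_exists_misclassification_gt_le hκ hγ D hn
      (fun f hf => N.continuous_of_mem_functions hf) ht (B := fun S => min (B₁ S) (B₂ S))
      fun S m f hf => le_min (rademacher_lossVec_le_norm hκ N hγ hn S hf)
        (rademacher_lossVec_le_param hκ N hγ hn S hf)).trans ?_)
  · simp only [Set.mem_compl_iff, Set.mem_ofPred_eq, not_forall, exists_prop] at hS ⊢
    obtain ⟨f, hf, hS⟩ := hS
    refine ⟨f, hf, ?_⟩
    rw [h1, h2] at hS
    by_contra! hle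
    refine hS ⟨hle.trans ?_, hle.trans ?_⟩
    · have : 2 * min (B₁ S) (B₂ S) / n ≤ 2 * B₁ S / n := by
        gcongr
        exact min_le_left _ _
      linarith
    · have : 2 * min (B₁ S) (B₂ S) / n ≤ 2 * B₂ S / n := by
        gcongr
        exact min_le_right _ _
      linarith
  · refine ENNReal.ofReal_le_ofReal ?_
    rw [Real.exp_neg, Real.exp_log (by positivity), inv_div]
    linarith
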